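/- Consider linear regression $Y_i=\beta_0+\sum_{j=1}^pX_{ij}\beta_j+\epsilon_i$, $i=1,\dots,n$, with a fixed design whose predictors are standardized ($\sum_iX_{ij}=0$, $\|\mathbf X_j\|=1$), a response that is centered before fitting, and independent errors with $\mathbb E e^{s\epsilon_i}\le e^{\sigma^2s^2/2}$ for all $s$ (sub-Gaussian, mean zero). All quantities, including $n$ and the number $S$ of nonzero coefficients, may change along a sequence with $p\to\infty$. Let $K=\{j:\beta_j\ne0\}$, $S=|K|$, $\mu=\max_{j>k}|\mathbf X_j^T\mathbf X_k|$; for $a,b\in K$ let $q_1=|\{j:|\beta_j|\ge|\beta_a|\}|/S$, $q_2=|\{j:0<|\beta_j|\le|\beta_b|\}|/S$, and $$\mu_{\mathrm{FL}}=\min\Bigl\{\frac1{2(1-q_2)S-1},\frac1{(2-q_1)S}\Bigr\},\qquad \mu_{\mathrm L}=\frac1{2S-1}.$$ FLASH starts from the zero coefficient vector and an empty active set $\mathcal A$. At step $l$ it adds to $\mathcal A$ the (not yet entered) variable $\mathbf X_j$ with the largest absolute correlation $|c_j|$ with the current residual, and moves the coefficients in the direction $h_{\mathcal A}=(X_{\mathcal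 A}^TX_{\mathcal A})^{-1}c_{\mathcal A}$ by a distance $\gamma=\gamma_L+\delta_l(1-\gamma_L)$, where $\gamma_L$ is the distance at which the absolute correlation of a variable that has not entered reaches the largest active one ($\gamma_L=1$ if there is none), and distance $1$ brings all active correlations to zero. A variable whose coefficient hits zero on the way leaves $\mathcal A$, and it returns when its absolute correlation reaches the value it would have had it stayed (the direction being updated accordingly within the step); a variable whose correlation is to be kept at zero thus never leaves. Block FLASH has $\delta_{l^*}=1$ for one break point $l^*$ and $\delta_l=0$ for all other $l$. Its estimators are the points, at position $t\in[0,1]$, of the segments joining the solution after $l$ steps to the least squares solution on the support of that solution; the tuning parameters are $l^*$, $l$ and $t$. **Theorem.** For all $\sigma\ge0$ and $\xi>0$ there are constants $c_1,c_3>0$, depending on $\sigma$ and $\xi$ only, such that the following holds. Suppose that, along the sequence, $\min_{j\in K}|\beta_j|>c_1\sqrt{S\log p}$, that $|\beta_a/\beta_b|>c_3\sqrt S$ for some pair $a,b\in K$, and that $\mu<\mu_{\mathrm{FL}}(1-\xi)$, with $\mu_{\mathrm{FL}}$ computed from this pair. Then there are non-random tuning parameters $l^*,l,t$ (depending on the position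 in the sequence) such that, with probability tending to one as $p\to\infty$, the block FLASH estimator exists and, however ties are broken, satisfies $\operatorname{sign}(\hat\beta)=\operatorname{sign}(\beta)$ componentwise. Moreover $\mu_{\mathrm{FL}}>\mu_{\mathrm L}$ whenever $q_1S>1$. -/

import Mathlib

open Filter Topology MeasureTheory ProbabilityTheory
open scoped NNReal Matrix

noncomputable section

/-- The vector of "correlations" `Xᵀ (y - X b)` between the predictors and the residuals at the
coefficient vector `b`. -/
def corr {n p : ℕ} (X : Matrix (Fin n) (Fin p) ℝ) (y : Fin n → ℝ) (b : Fin p → ℝ) : Fin p → ℝ :=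
  Xᵀ *ᵥ (y - X *ᵥ b)

/-- The submatrix `X_A` of the columns of `X` with index in `A`. -/
def colsOn {n p : ℕ} (X : Matrix (Fin n) (Fin p) ℝ) (A : Finset (Fin p)) :
    Matrix (Fin n) A ℝ :=
  X.submatrix id Subtype.val

/-- `h` is the direction vector of the active set `A` for the correlations `c`:
`h_A = (X_Aᵀ X_A)⁻¹ c_A`, and `h` vanishes off `A`. -/
def IsDirection {n p : ℕ} (X : Matrix (Fin n) (Fin p) ℝ) (c : Fin p → ℝ) (A : Finset (Fin p))
    (h : Fin p → ℝ) : Prop :=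
  IsUnit ((colsOn X A)ᵀ * colsOn X A).det ∧
  (fun j : A => h j) = ((colsOn X A)ᵀ * colsOn X A)⁻¹ *ᵥ (fun j : A => c j) ∧
  ∀ j, j ∉ A → h j = 0

/-- The path of one step of FLASH, with the zero crossing modification.  The variables that have
entered the model so far are those in `E`; `v j` is the absolute correlation that `j ∈ E` has at
the beginning of the step if it is active, or would have if it had never been removed; `b` is the
coefficient vector at the beginning of the step.  The time `γ` runs from `0` to `1`, and `(1 - γ) v j`
is the value to which the absolute correlation of an active `j` has been driven at time `γ`
(time `1` is the Forward Selection point).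

At every time `γ < 1` there is a current active set `A ⊆ E`, and until some later time `η` the path
moves along a straight line in the direction `(X_Aᵀ X_A)⁻¹ c_A`, where
* the correlation of an active variable is at its prescribed value, and its coefficient
  does not pass through zero, that is, does not take the sign opposite to the correlation
  (a variable whose coefficient would do so is removed from the active set);
* a variable of `E` that is out of the active set has coefficient zero, and its absolute
  correlation does not exceed the value it would have, had it remained active
  (once it reaches this value, and would exceed it, the variable is added back).

For a variable with `v j = 0` the last condition says that its correlation stays
at zero, so that it is in effect never removed. -/
structure IsStepPath {n p : ℕ} (X : Matrix (Fin n) (Fin p) ℝ) (y : Fin n → ℝ)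
    (E : Finset (Fin p)) (v b : Fin p → ℝ) (g : ℝ → Fin p → ℝ) : Prop where
  start : g 0 = b
  cont : ContinuousOn g (Set.Icc 0 1)
  move : ∀ γ ∈ Set.Ico (0 : ℝ) 1, ∃ A ⊆ E, ∃ h : Fin p → ℝ, ∃ η ∈ Set.Ioc γ 1,
    IsDirection X (corr X y (g γ)) A h ∧
    (∀ s ∈ Set.Icc γ η, g s = g γ + ((s - γ) / (1 - γ)) • h) ∧
    (∀ j ∈ A, |corr X y (g γ) j| = (1 - γ) * v j ∧
      ∀ s ∈ Set.Icc γ η, 0 ≤ corr X y (g γ) j * g s j) ∧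
    (∀ j ∈ E \ A, g γ j = 0 ∧ ∀ s ∈ Set.Icc γ η, |corr X y (g s) j| ≤ (1 - s) * v j)

/-- `γL` is the Lasso distance along the path `g` of a step: the first time at which the absolute
correlation of a variable that has not entered reaches the maximum of the active absolute
correlations, or the time `1` (all active correlations are at zero) if that does not happen
before. -/
def IsLassoDistance {n p : ℕ} (X : Matrix (Fin n) (Fin p) ℝ) (y : Fin n → ℝ)
    (E : Finset (Fin p)) (v : Fin p → ℝ) (g : ℝ → Fin p → ℝ) (γL : ℝ) : Prop :=
  IsLeast {γ : ℝ | γ ∈ Set.Icc (0 : ℝ) 1 ∧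
    (γ = 1 ∨ ∃ j, j ∉ E ∧ ∀ i ∈ E, (1 - γ) * v i ≤ |corr X y (g γ) j|)} γL

/-- `FlashRun X y δ l b E v`: after `l` steps of the FLASH algorithm with step parameters
`δ 1, δ 2, …` the coefficient vector is `b`, the variables that have entered are those in `E`, and
`v` holds the prescribed absolute correlations of the variables in `E`.  Ties for the largest
absolute correlation may be broken in any way. -/
inductive FlashRun {n p : ℕ} (X : Matrix (Fin n) (Fin p) ℝ) (y : Fin n → ℝ) (δ : ℕ → ℝ) :
    ℕ → (Fin p → ℝ) → Finset (Fin p) → (Fin p → ℝ) → Prop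
  | init : FlashRun X y δ 0 0 ∅ 0
  | step (l : ℕ) (b : Fin p → ℝ) (E : Finset (Fin p)) (v : Fin p → ℝ) (k : Fin p)
      (g : ℝ → Fin p → ℝ) (γL γ : ℝ) (run : FlashRun X y δ l b E v)
      (not_done : corr X y b ≠ 0)
      (new : k ∉ E) (maximal : ∀ j, j ∉ E → |corr X y b j| ≤ |corr X y b k|)
      (path : IsStepPath X y (insert k E) (Function.update v k |corr X y b k|) b g)
      (lasso : IsLassoDistance X y (insert k E) (Function.update v k |corr X y b k|) g γL)
      (stepsize : γ = γL + δ (l + 1) * (1 - γL)) :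
      FlashRun X y δ (l + 1) (g γ) (insert k E)
        ((1 - γ) • Function.update v k |corr X y b k|)

/-- `b'` is an ordinary least squares solution on the variables in the support of `b`. -/
def IsUnshrunk {n p : ℕ} (X : Matrix (Fin n) (Fin p) ℝ) (y : Fin n → ℝ)
    (b b' : Fin p → ℝ) : Prop :=
  ∀ j, (b j = 0 → b' j = 0) ∧ (b j ≠ 0 → corr X y b' j = 0)

/-- The step parameters of block FLASH with break point `lstar`: one Forward step, at step `lstar`,
and Lasso steps otherwise. -/
def blockDelta (lstar : ℕ) : ℕ → ℝ := fun l => if l = lstar then 1 else 0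

/-- `bhat` is the (relaxed) block FLASH estimator with break point `lstar`, read after `l` steps, at
position `t ∈ [0, 1]` of the relaxation path from the FLASH solution (`t = 0`) to the ordinary
least squares solution on its variables (`t = 1`). -/
def IsBlockFlash {n p : ℕ} (X : Matrix (Fin n) (Fin p) ℝ) (y : Fin n → ℝ)
    (lstar l : ℕ) (t : ℝ) (bhat : Fin p → ℝ) : Prop :=
  ∃ (b : Fin p → ℝ) (E : Finset (Fin p)) (v b' : Fin p → ℝ),
    FlashRun X y (blockDelta lstar) l b E v ∧ IsUnshrunk X y b b' ∧
    bhat = (1 - t) • b + t • b'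

/-- `bhat` recovers the correct signed support of `β`. -/
def RecoversSignedSupport {p : ℕ} (bhat β : Fin p → ℝ) : Prop :=
  ∀ j, SignType.sign (bhat j) = SignType.sign (β j)

/-- The vector `Y` shifted to have mean zero. -/
def centered {n : ℕ} (Y : Fin n → ℝ) : Fin n → ℝ := fun i => Y i - (∑ k, Y k) / n

/-- The response of the linear regression model with intercept `β₀` and errors `e`. -/
def response {n p : ℕ} (X : Matrix (Fin n) (Fin p) ℝ) (β₀ : ℝ) (β : Fin p → ℝ) (e : Fin n → ℝ) :
    Fin n → ℝ :=
  fun i => β₀ + ∑ j, X i j * β j + e i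

/-- Every predictor has mean zero and Euclidean norm one. -/
def IsStandardized {n p : ℕ} (X : Matrix (Fin n) (Fin p) ℝ) : Prop :=
  ∀ j, ∑ i, X i j = 0 ∧ ∑ i, X i j ^ 2 = 1

/-- The maximal absolute correlation `max_{j > k} |X_jᵀ X_k|` between two predictors. -/
def maxCorr {n p : ℕ} (X : Matrix (Fin n) (Fin p) ℝ) : ℝ :=
  ⨆ jk : {jk : Fin p × Fin p // jk.2 < jk.1}, |∑ i, X i jk.1.1 * X i jk.1.2|

/-- The number `S` of signal variables. -/
def numSignal {p : ℕ} (β : Fin p → ℝ) : ℕ := (Finset.univ.filter fun j => β j ≠ 0).card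

/-- The fraction `q₁` of large coefficients (`|β_j| ≥ |β_a|`) among the nonzero ones. -/
def fracLarge {p : ℕ} (β : Fin p → ℝ) (a : Fin p) : ℝ :=
  ((Finset.univ.filter fun j => |β a| ≤ |β j|).card : ℝ) / numSignal β

/-- The fraction `q₂` of small coefficients (`0 < |β_j| ≤ |β_b|`) among the nonzero ones. -/
def fracSmall {p : ℕ} (β : Fin p → ℝ) (b : Fin p) : ℝ :=
  ((Finset.univ.filter fun j => 0 < |β j| ∧ |β j| ≤ |β b|).card : ℝ) / numSignal β

/-- The correlation bound `μ_L` of the Lasso. -/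
def muLasso {p : ℕ} (β : Fin p → ℝ) : ℝ := 1 / (2 * (numSignal β : ℝ) - 1)

/-- The correlation bound `μ_FL` of block FLASH. -/
def muFlash {p : ℕ} (β : Fin p → ℝ) (a b : Fin p) : ℝ :=
  min (1 / (2 * (1 - fracSmall β b) * (numSignal β : ℝ) - 1))
    (1 / ((2 - fracLarge β a) * (numSignal β : ℝ)))

end

/-!
The proof is a coordinatewise perturbation argument. Write `c = Xᵀ (y - X x)` for the correlations
at coefficients `x`, so that `c = Xᵀ X (β - x) + w` with the noise `w = Xᵀ (y - X β)`. Since `Xᵀ X`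
is close to the identity, `c` is close to the coefficient error `d = β - x`: if `lam` bounds `|c|` on
the support `K` of `d` and `c` vanishes on `F ⊆ K`, then
`|c j - d j| ≤ (1 - ξ) lam + 2 N / ξ` for all `j`, provided that `μ (|K| - 1 + |K \ F|) ≤ 1 - ξ`
and `|w| ≤ N` (`IsIncoherent.abs_corr_sub_le`). Three consequences, as long as `lam` is large
compared with `N`: a variable with `d j = 0` has `|c j| < lam`, so only variables of `K` enter; a
variable of `K` that has not entered forces `lam` to be of the order of its coefficient; and a
variable that enters at level `lam` has a coefficient of order at least `lam`.

This is used twice. Before the Forward step, `K` is the set of variables with `|β_j| > |β_b|`, the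
smaller coefficients count as noise of order `|β_b|`, and `F = ∅`; the condition on `μ` is the first
bound in `muFlash` (`IsRecoverable.first_phase`). After the Forward step, `K` is the whole support
and `F` the set of variables entered so far, whose correlations are zero for the rest of the run;
the condition is the second bound in `muFlash` (`IsRecoverable.second_phase`). The order of entry
depends on the noise, but the break point must not: it is the number of variables with
`|β_j| ≥ 21 |β_b| / ξ²`. If a large variable were missing after that many steps, all the variables
entered would be above this threshold, and there would be too many of them
(`IsRecoverable.phaseInvariant`). After as many steps as there are signal variables, exactly these
have entered and the correlations are of the order of the noise, so the coefficients have the right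
signs (`IsRecoverable.recovers_of_run`).

That a run exists is a separate matter, since ties and simultaneous zero crossings are allowed. The
path of a step is the path of solutions of the Lasso on the entered variables with weights
`(1 - γ) v`. These are unique and continuous in `γ` by restricted strong convexity, and linear to
the right of each time because only finitely many sign patterns occur, each of them on an interval
(`exists_isStepPath`).

The noise is at most `2 (σ + 1) √(log p)` in all coordinates with probability at least `1 - 2 / p`,
by a union bound (`measureReal_exists_lt_abs_le`).
-/

/-! ### Designs with small mutual coherence -/

/-- The columns of `X` are unit vectors whose pairwise inner products are at most `μ` in absolute
value. -/
structure IsIncoherent {n p : ℕ} (X : Matrix (Fin n) (Fin p) ℝ) (μ : ℝ) : Prop where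
  norm_one : ∀ j, ∑ i, X i j ^ 2 = 1
  inner_le : ∀ j k, j ≠ k → |∑ i, X i j * X i k| ≤ μ

lemma corr_eq_add {n p : ℕ} (X : Matrix (Fin n) (Fin p) ℝ) (y : Fin n → ℝ) (b b' : Fin p → ℝ) :
    corr X y b = Xᵀ *ᵥ (X *ᵥ (b' - b)) + corr X y b' := by
  simp only [corr, Matrix.mulVec_sub]
  abel

lemma transpose_mulVec_mulVec_apply {n p : ℕ} (X : Matrix (Fin n) (Fin p) ℝ) (d : Fin p → ℝ)
    (j : Fin p) : (Xᵀ *ᵥ (X *ᵥ d)) j = ∑ k, (∑ i, X i j * X i k) * d k := by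
  rw [Matrix.mulVec_mulVec, Matrix.mulVec, dotProduct]
  simp [Matrix.mul_apply]

lemma sum_mulVec_sq {n p : ℕ} (X : Matrix (Fin n) (Fin p) ℝ) (d : Fin p → ℝ) :
    ∑ i, (X *ᵥ d) i ^ 2 = ∑ j, d j * (Xᵀ *ᵥ (X *ᵥ d)) j := by
  have h : (X *ᵥ d) ⬝ᵥ (X *ᵥ d) = d ⬝ᵥ (Xᵀ *ᵥ (X *ᵥ d)) := by
    rw [Matrix.mulVec_transpose, dotProduct_comm d, ← Matrix.dotProduct_mulVec]
  simpa [dotProduct, sq] using h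

namespace IsIncoherent

variable {n p : ℕ} {X : Matrix (Fin n) (Fin p) ℝ} {μ ξ : ℝ}

/-- The Gram matrix of an incoherent design is close to the identity. -/
lemma abs_gram_sub_le (hX : IsIncoherent X μ) (d : Fin p → ℝ) (j : Fin p) :
    |(Xᵀ *ᵥ (X *ᵥ d)) j - d j| ≤ μ * (∑ i, |d i| - |d j|) := by
  have h1 : (Xᵀ *ᵥ (X *ᵥ d)) j - d j
      = ∑ k ∈ Finset.univ.erase j, (∑ i, X i j * X i k) * d k := by
    rw [transpose_mulVec_mulVec_apply, ← Finset.add_sum_erase _ _ (Finset.mem_univ j)]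
    have := hX.norm_one j
    simp only [sq] at this
    rw [this]; ring
  have h2 : ∑ i, |d i| - |d j| = ∑ k ∈ Finset.univ.erase j, |d k| := by
    rw [← Finset.add_sum_erase _ _ (Finset.mem_univ j)]; ring
  rw [h1, h2, Finset.mul_sum]
  refine (Finset.abs_sum_le_sum_abs _ _).trans (Finset.sum_le_sum fun k hk => ?_)
  rw [abs_mul]
  exact mul_le_mul_of_nonneg_right (hX.inner_le j k (Finset.ne_of_mem_erase hk).symm)
    (abs_nonneg _)

/-- The correlations `c = Xᵀ X d + w` differ from the coefficient errors `d` by at most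
`(1 - ξ) lam` up to noise, where `lam` bounds the correlations on the support `K` of `d`.
The subset `F` collects variables whose correlation has been driven to zero: each of them
relaxes the coherence condition. -/
lemma abs_corr_sub_le (hX : IsIncoherent X μ) (hξ0 : 0 < ξ) (hξ1 : ξ < 1) (hμ : 0 ≤ μ)
    {K F : Finset (Fin p)} (hF : F ⊆ K)
    (hK : μ * (K.card - 1 + (K \ F).card) ≤ 1 - ξ) (hK1 : μ * K.card ≤ 1)
    {d w c : Fin p → ℝ} (hc : c = Xᵀ *ᵥ (X *ᵥ d) + w) (hd : ∀ j ∉ K, d j = 0) {N lam : ℝ}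
    (hw : ∀ j, |w j| ≤ N) (hN : 0 ≤ N) (hlam : 0 ≤ lam) (hcK : ∀ j ∈ K, |c j| ≤ lam)
    (hcF : ∀ j ∈ F, c j = 0) (j : Fin p) :
    |c j - d j| ≤ (1 - ξ) * lam + 2 * N / ξ := by
  set D := ∑ i, |d i| with hD
  have hDK : D = ∑ i ∈ K, |d i| := by
    rw [hD, ← Finset.sum_subset (Finset.subset_univ K)]
    intro i _ hi; simp [hd i hi]
  have hD0 : 0 ≤ D := Finset.sum_nonneg fun i _ => abs_nonneg _
  have hcd : ∀ i, |c i - d i| ≤ μ * (D - |d i|) + N := fun i => by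
    have e : c i - d i = ((Xᵀ *ᵥ (X *ᵥ d)) i - d i) + w i := by rw [hc]; simp; ring
    rw [e]
    exact (abs_add_le _ _).trans (add_le_add (hX.abs_gram_sub_le d i) (hw i))
  -- summing the coordinatewise bounds over `K` bounds the `ℓ¹` norm `D` of `d`
  have hsum : D ≤ (K \ F).card * lam + μ * ((K.card - 1) * D) + K.card * N := by
    have h1 : ∀ i ∈ K, |d i| ≤ |c i| + (μ * (D - |d i|) + N) := fun i _ => by
      have := abs_sub_abs_le_abs_sub (d i) (c i)
      rw [abs_sub_comm] at this
      linarith [hcd i]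
    have h2 : ∑ i ∈ K, |c i| ≤ (K \ F).card * lam := by
      rw [← Finset.sum_sdiff hF, Finset.sum_eq_zero (s := F) (fun i hi => by simp [hcF i hi]),
        add_zero, ← nsmul_eq_mul]
      exact Finset.sum_le_card_nsmul _ _ _ fun i hi => hcK i (Finset.mem_sdiff.1 hi).1
    have h3 := Finset.sum_le_sum h1
    rw [← hDK, Finset.sum_add_distrib, Finset.sum_add_distrib, ← Finset.mul_sum,
      Finset.sum_sub_distrib, ← hDK] at h3
    simp only [Finset.sum_const, nsmul_eq_mul] at h3
    nlinarith
  set r : ℝ := ((K \ F).card : ℝ)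
  set k : ℝ := (K.card : ℝ)
  have hr0 : (0 : ℝ) ≤ r := Nat.cast_nonneg _
  have hden : ξ ≤ 1 - μ * (k - 1) := by nlinarith
  have hden0 : 0 < 1 - μ * (k - 1) := by linarith
  have hmain : μ * D ≤ (1 - ξ) * lam + N / ξ := by
    have h1 : μ * D * (1 - μ * (k - 1)) ≤ μ * r * lam + μ * k * N := by nlinarith
    have h2 : μ * r ≤ (1 - ξ) * (1 - μ * (k - 1)) := by
      -- for `k = 0` the factor `k - 1` is negative, but then `r = 0`
      rcases Nat.eq_zero_or_pos K.card with h0 | h0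
      · have hr : r = 0 := by
          have : (K \ F).card ≤ K.card := Finset.card_le_card Finset.sdiff_subset
          simp only [r]; exact_mod_cast (by omega : (K \ F).card = 0)
        rw [hr, mul_zero]; exact mul_nonneg (by linarith) hden0.le
      · have : (1 : ℝ) ≤ k := by simp only [k]; exact_mod_cast h0
        nlinarith [mul_nonneg (mul_nonneg hμ (by linarith : (0 : ℝ) ≤ k - 1)) hξ0.le]
    have h3 : N ≤ N / ξ * (1 - μ * (k - 1)) := by
      calc N = N / ξ * ξ := by field_simp
        _ ≤ _ := mul_le_mul_of_nonneg_left hden (div_nonneg hN hξ0.le)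
    have h4 : μ * D * (1 - μ * (k - 1)) ≤ ((1 - ξ) * lam + N / ξ) * (1 - μ * (k - 1)) := by
      nlinarith [mul_le_mul_of_nonneg_right h2 hlam, mul_le_mul_of_nonneg_right hK1 hN]
    exact le_of_mul_le_mul_right h4 hden0
  have hNξ : N ≤ N / ξ := by
    rw [le_div_iff₀ hξ0]; nlinarith
  have h5 := hcd j
  have h6 : 0 ≤ μ * |d j| := mul_nonneg hμ (abs_nonneg _)
  have h7 : 2 * N / ξ = N / ξ + N / ξ := by ring
  rw [h7]; linarith

/-- Restricted strong convexity of the least squares loss. -/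
lemma mul_sum_sq_le (hX : IsIncoherent X μ) (hμ : 0 ≤ μ) {K : Finset (Fin p)}
    (hK : μ * (K.card - 1) ≤ 1 - ξ) {x : Fin p → ℝ} (hx : ∀ j ∉ K, x j = 0) :
    ξ * ∑ j, x j ^ 2 ≤ ∑ i, (X *ᵥ x) i ^ 2 := by
  set D := ∑ i, |x i| with hD
  have hDK : D = ∑ i ∈ K, |x i| := by
    rw [hD, ← Finset.sum_subset (Finset.subset_univ K)]
    intro i _ hi; simp [hx i hi]
  have hQK : ∑ j, x j ^ 2 = ∑ j ∈ K, |x j| ^ 2 := by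
    rw [← Finset.sum_subset (Finset.subset_univ K)]
    · simp
    · intro i _ hi; simp [hx i hi]
  have hCS : D ^ 2 ≤ K.card * ∑ j, x j ^ 2 := by
    rw [hDK, hQK]; exact sq_sum_le_card_mul_sum_sq
  have h1 : ∀ j, (1 + μ) * x j ^ 2 - μ * D * |x j| ≤ x j * (Xᵀ *ᵥ (X *ᵥ x)) j := fun j => by
    have h := hX.abs_gram_sub_le x j
    have h2 : -(|x j| * (μ * (D - |x j|))) ≤ x j * ((Xᵀ *ᵥ (X *ᵥ x)) j - x j) := by
      refine (neg_le_neg (mul_le_mul_of_nonneg_left h (abs_nonneg (x j)))).trans ?_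
      rw [← abs_mul]; exact neg_abs_le _
    nlinarith [sq_abs (x j)]
  have h3 := Finset.sum_le_sum fun j (_ : j ∈ Finset.univ) => h1 j
  rw [Finset.sum_sub_distrib, ← Finset.mul_sum, ← Finset.mul_sum, ← sum_mulVec_sq, ← hD] at h3
  have hQ0 : 0 ≤ ∑ j, x j ^ 2 := Finset.sum_nonneg fun j _ => sq_nonneg _
  nlinarith [mul_le_mul_of_nonneg_left hCS hμ, mul_le_mul_of_nonneg_right hK hQ0]

end IsIncoherent

/-! ### The weighted Lasso on a set of variables -/

/-- On vectors supported on `E` the least squares loss is strongly convex with modulus `ξ`. -/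
def IsRestrictedConvex {n p : ℕ} (X : Matrix (Fin n) (Fin p) ℝ) (ξ : ℝ) (E : Finset (Fin p)) :
    Prop :=
  ∀ x : Fin p → ℝ, (∀ j ∉ E, x j = 0) → ξ * ∑ j, x j ^ 2 ≤ ∑ i, (X *ᵥ x) i ^ 2

/-- `b` satisfies the optimality conditions for minimizing
`‖y - X b‖² / 2 + ∑ j ∈ E, v j * |b j|` over the vectors supported on `E`. -/
def IsWeightedLasso {n p : ℕ} (X : Matrix (Fin n) (Fin p) ℝ) (y : Fin n → ℝ)
    (E : Finset (Fin p)) (v b : Fin p → ℝ) : Prop :=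
  (∀ j ∉ E, b j = 0) ∧ ∀ j ∈ E, |corr X y b j| ≤ v j ∧ corr X y b j * b j = v j * |b j|

section WeightedLasso

variable {n p : ℕ} {X : Matrix (Fin n) (Fin p) ℝ} {y : Fin n → ℝ} {ξ : ℝ}
  {E : Finset (Fin p)}

lemma IsRestrictedConvex.mono (h : IsRestrictedConvex X ξ E) {A : Finset (Fin p)} (hA : A ⊆ E) :
    IsRestrictedConvex X ξ A :=
  fun x hx => h x fun j hj => hx j fun hjA => hj (hA hjA)

lemma IsRestrictedConvex.eq_zero (h : IsRestrictedConvex X ξ E) (hξ : 0 < ξ) {x : Fin p → ℝ}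
    (hx : ∀ j ∉ E, x j = 0) (hG : ∀ j ∈ E, (Xᵀ *ᵥ (X *ᵥ x)) j = 0) : x = 0 := by
  have h1 := h x hx
  rw [sum_mulVec_sq, Finset.sum_eq_zero (f := fun j => x j * (Xᵀ *ᵥ (X *ᵥ x)) j)] at h1
  · have h2 : ∑ j, x j ^ 2 = 0 :=
      le_antisymm (by by_contra! h3; nlinarith [mul_pos hξ h3])
        (Finset.sum_nonneg fun j _ => sq_nonneg _)
    funext j
    exact pow_eq_zero_iff two_ne_zero |>.1 <|
      (Finset.sum_eq_zero_iff_of_nonneg fun j _ => sq_nonneg (x j)).1 h2 j (Finset.mem_univ j)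
  · intro j _
    by_cases hj : j ∈ E
    · simp [hG j hj]
    · simp [hx j hj]

/-- The one-dimensional optimality condition behind the Lasso. -/
lemma abs_le_and_mul_eq_of_forall_le {b c w : ℝ} (hw : 0 ≤ w)
    (h : ∀ t : ℝ, 0 ≤ t ^ 2 / 2 - t * c + w * (|b + t| - |b|)) :
    |c| ≤ w ∧ c * b = w * |b| := by
  have hc : |c| ≤ w := by
    by_contra! hc
    have key : ∀ t, t * c = (|c| - w) * |c| → |t| = |c| - w → False := fun t h1 h2 => by
      have h3 := h t
      have h4 : |b + t| - |b| ≤ |t| := by linarith [abs_add_le b t]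
      have h5 : t ^ 2 = (|c| - w) ^ 2 := by rw [← sq_abs, h2]
      rw [h1, h5] at h3
      rw [h2] at h4
      nlinarith [mul_le_mul_of_nonneg_left h4 hw]
    rcases le_total 0 c with h0 | h0
    · exact key (|c| - w) (by rw [abs_of_nonneg h0]) (abs_of_pos (by linarith))
    · exact key (-(|c| - w)) (by rw [abs_of_nonpos h0]; ring)
        (by rw [abs_neg]; exact abs_of_pos (by linarith))
  refine ⟨hc, le_antisymm ?_ ?_⟩
  · calc c * b ≤ |c * b| := le_abs_self _
      _ = |c| * |b| := abs_mul _ _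
      _ ≤ w * |b| := mul_le_mul_of_nonneg_right hc (abs_nonneg _)
  · have hs : ∀ s ∈ Set.Icc (0 : ℝ) 1, s * (w * |b| - c * b) ≤ s * (s * b ^ 2 / 2) := by
      intro s hs
      have h1 := h (-(s * b))
      rw [show b + -(s * b) = (1 - s) * b by ring, abs_mul,
        abs_of_nonneg (by linarith [hs.2] : 0 ≤ 1 - s)] at h1
      nlinarith
    by_contra! hlt
    set D := w * |b| - c * b
    have hD : 0 < D := by simp only [D]; linarith
    have h1 : D ≤ b ^ 2 / 2 := by simpa using hs 1 (by simp)
    have hb : 0 < b ^ 2 := by linarith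
    have hq : 0 < D / b ^ 2 := div_pos hD hb
    have h2 := le_of_mul_le_mul_left
      (hs (D / b ^ 2) ⟨hq.le, (div_le_one hb).2 (by linarith)⟩) hq
    rw [div_mul_cancel₀ _ hb.ne'] at h2
    linarith

lemma sum_sq_residual_add_smul_single (X : Matrix (Fin n) (Fin p) ℝ) (y : Fin n → ℝ)
    (b : Fin p → ℝ) {j : Fin p} (hj : ∑ i, X i j ^ 2 = 1) (t : ℝ) :
    ∑ i, (y - X *ᵥ (b + Pi.single j t)) i ^ 2
      = ∑ i, (y - X *ᵥ b) i ^ 2 - 2 * t * corr X y b j + t ^ 2 := by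
  have h1 : ∀ i, (y - X *ᵥ (b + Pi.single j t)) i = (y - X *ᵥ b) i - X i j * t := fun i => by
    simp [Matrix.mulVec_add]; ring
  have h2 : corr X y b j = ∑ i, X i j * (y - X *ᵥ b) i := rfl
  rw [h2, Finset.mul_sum, ← mul_one (t ^ 2), ← hj, Finset.mul_sum, ← Finset.sum_sub_distrib,
    ← Finset.sum_add_distrib]
  exact Finset.sum_congr rfl fun i _ => by rw [h1]; ring

/-- Under restricted strong convexity the weighted Lasso has a solution. -/
lemma exists_isWeightedLasso (hX : ∀ j, ∑ i, X i j ^ 2 = 1) (hE : IsRestrictedConvex X ξ E)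
    (hξ : 0 < ξ) (y : Fin n → ℝ) {v : Fin p → ℝ} (hv : ∀ j ∈ E, 0 ≤ v j) :
    ∃ b, IsWeightedLasso X y E v b := by
  set f : (Fin p → ℝ) → ℝ :=
    fun b => (∑ i, (y - X *ᵥ b) i ^ 2) / 2 + ∑ j ∈ E, v j * |b j| with hf
  have hfc : Continuous f := by
    have : Continuous fun b : Fin p → ℝ => X *ᵥ b := by fun_prop
    simp only [hf]
    fun_prop
  set T : Set (Fin p → ℝ) := {b | (∀ j ∉ E, b j = 0) ∧ f b ≤ f 0} with hT
  have hTc : IsClosed T := by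
    simp only [hT, Set.ofPred_and, Set.ofPred_forall]
    refine IsClosed.inter (isClosed_iInter fun j => isClosed_iInter fun _ => ?_)
      (isClosed_le hfc continuous_const)
    exact isClosed_eq (continuous_apply j) continuous_const
  have hTb : T ⊆ Metric.closedBall 0 (Real.sqrt (4 * (∑ i, y i ^ 2) / ξ)) := by
    rintro b ⟨hb, hfb⟩
    rw [mem_closedBall_zero_iff, pi_norm_le_iff_of_nonneg (Real.sqrt_nonneg _)]
    intro j
    have h1 : 0 ≤ ∑ j ∈ E, v j * |b j| :=
      Finset.sum_nonneg fun j hj => mul_nonneg (hv j hj) (abs_nonneg _)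
    have h2 : ∑ i, (y - X *ᵥ b) i ^ 2 ≤ ∑ i, y i ^ 2 := by
      simp only [hf, Pi.zero_apply, abs_zero, mul_zero, Finset.sum_const_zero,
        Matrix.mulVec_zero, sub_zero, add_zero] at hfb
      linarith
    have h3 : ∑ i, (X *ᵥ b) i ^ 2 ≤ 2 * ∑ i, y i ^ 2 + 2 * ∑ i, (y - X *ᵥ b) i ^ 2 := by
      rw [Finset.mul_sum, Finset.mul_sum, ← Finset.sum_add_distrib]
      refine Finset.sum_le_sum fun i _ => ?_
      simp only [Pi.sub_apply]
      nlinarith [sq_nonneg (2 * y i - (X *ᵥ b) i)]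
    have h4 := hE b hb
    have h5 : b j ^ 2 ≤ ∑ j, b j ^ 2 :=
      Finset.single_le_sum (f := fun j => b j ^ 2) (fun j _ => sq_nonneg _) (Finset.mem_univ j)
    rw [Real.norm_eq_abs]
    apply Real.abs_le_sqrt
    rw [le_div_iff₀ hξ]
    nlinarith
  have hTk : IsCompact T := (isCompact_closedBall _ _).of_isClosed_subset hTc hTb
  obtain ⟨b, hbT, hmin⟩ := hTk.exists_isMinOn ⟨0, by simp [hT]⟩ hfc.continuousOn
  have hmin' : ∀ b', (∀ j ∉ E, b' j = 0) → f b ≤ f b' := fun b' hb' => by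
    by_cases h : f b' ≤ f 0
    · exact hmin ⟨hb', h⟩
    · exact hbT.2.trans (not_le.1 h).le
  refine ⟨b, hbT.1, fun j hj => abs_le_and_mul_eq_of_forall_le (hv j hj) fun t => ?_⟩
  have h1 := hmin' (b + Pi.single j t) fun k hk => by
    have : k ≠ j := fun h => hk (h ▸ hj)
    simp [hbT.1 k hk, this]
  have h2 : ∑ k ∈ E, v k * |(b + Pi.single j t : Fin p → ℝ) k|
      = ∑ k ∈ E, v k * |b k| + v j * (|b j + t| - |b j|) := by
    rw [← Finset.add_sum_erase _ _ hj, ← Finset.add_sum_erase _ (fun k => v k * |b k|) hj,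
      Finset.sum_congr rfl (g := fun k => v k * |b k|) fun k hk => by
        simp [Finset.ne_of_mem_erase hk]]
    simp only [Pi.add_apply, Pi.single_eq_same]
    ring
  simp only [hf] at h1
  rw [h2, sum_sq_residual_add_smul_single X y b (hX j)] at h1
  linarith

lemma corr_sub_corr (X : Matrix (Fin n) (Fin p) ℝ) (y : Fin n → ℝ) (b b' : Fin p → ℝ)
    (j : Fin p) : corr X y b' j - corr X y b j = (Xᵀ *ᵥ (X *ᵥ (b - b'))) j := by
  rw [corr_eq_add X y b' b]; simp

/-- Two weighted Lasso solutions are as close as their weights. -/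
lemma IsWeightedLasso.sum_mulVec_sub_sq_le {v v' b b' : Fin p → ℝ}
    (h : IsWeightedLasso X y E v b) (h' : IsWeightedLasso X y E v' b') :
    ∑ i, (X *ᵥ (b - b')) i ^ 2 ≤ ∑ j ∈ E, |v j - v' j| * |b j - b' j| := by
  rw [sum_mulVec_sq, ← Finset.sum_subset (Finset.subset_univ E)
    fun j _ hj => by simp [h.1 j hj, h'.1 j hj]]
  refine Finset.sum_le_sum fun j hj => ?_
  rw [← corr_sub_corr X y]
  obtain ⟨h1, h2⟩ := h.2 j hj
  obtain ⟨h1', h2'⟩ := h'.2 j hj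
  set c := corr X y b j
  set c' := corr X y b' j
  have h3 : b j * c' ≤ |b j| * v' j := (le_abs_self _).trans <| by
    rw [abs_mul]; exact mul_le_mul_of_nonneg_left h1' (abs_nonneg _)
  have h4 : b' j * c ≤ |b' j| * v j := (le_abs_self _).trans <| by
    rw [abs_mul]; exact mul_le_mul_of_nonneg_left h1 (abs_nonneg _)
  have h5 : (v j - v' j) * (|b' j| - |b j|) ≤ |v j - v' j| * |b j - b' j| := by
    refine (le_abs_self _).trans ?_
    rw [abs_mul, abs_sub_comm (b j)]
    exact mul_le_mul_of_nonneg_left (abs_abs_sub_abs_le _ _) (abs_nonneg _)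
  simp only [Pi.sub_apply]
  nlinarith

lemma IsWeightedLasso.unique (hE : IsRestrictedConvex X ξ E) (hξ : 0 < ξ) {v b b' : Fin p → ℝ}
    (h : IsWeightedLasso X y E v b) (h' : IsWeightedLasso X y E v b') : b = b' := by
  have h0 : ∀ j ∉ E, (b - b') j = 0 := fun j hj => by simp [h.1 j hj, h'.1 j hj]
  have h1 := hE _ h0
  have h2 := h.sum_mulVec_sub_sq_le h'
  simp only [sub_self, abs_zero, zero_mul, Finset.sum_const_zero] at h2
  have h3 : ∑ j, (b - b') j ^ 2 = 0 :=
    le_antisymm (by by_contra! h3; nlinarith [mul_pos hξ h3])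
      (Finset.sum_nonneg fun j _ => sq_nonneg _)
  funext j
  have := (Finset.sum_eq_zero_iff_of_nonneg fun j _ => sq_nonneg ((b - b') j)).1 h3 j
    (Finset.mem_univ j)
  exact sub_eq_zero.1 (pow_eq_zero_iff two_ne_zero |>.1 this)

/-- The weighted Lasso solution is a Lipschitz function of a common multiplier of the weights. -/
lemma IsWeightedLasso.abs_sub_le (hE : IsRestrictedConvex X ξ E) (hξ : 0 < ξ)
    {v b b' : Fin p → ℝ} {r r' : ℝ} (h : IsWeightedLasso X y E (r • v) b)
    (h' : IsWeightedLasso X y E (r' • v) b') (j : Fin p) :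
    |b j - b' j| ≤ Real.sqrt (∑ j ∈ E, v j ^ 2) / ξ * |r - r'| := by
  have h1 := (hE (b - b') fun j hj => by simp [h.1 j hj, h'.1 j hj]).trans
    (h.sum_mulVec_sub_sq_le h')
  have h2 : ∑ j ∈ E, |(r • v) j - (r' • v) j| * |b j - b' j|
      ≤ ∑ j ∈ E, (ξ / 2 * |b j - b' j| ^ 2 + |r - r'| ^ 2 * v j ^ 2 / (2 * ξ)) := by
    refine Finset.sum_le_sum fun j _ => ?_
    have e : |(r • v) j - (r' • v) j| = |r - r'| * |v j| := by
      rw [← abs_mul]; simp only [Pi.smul_apply, smul_eq_mul]; ring_nf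
    rw [e, ← sq_abs (v j)]
    have key : ∀ x u : ℝ, u * x ≤ ξ / 2 * x ^ 2 + u ^ 2 / (2 * ξ) := fun x u => by
      have : ξ / 2 * x ^ 2 + u ^ 2 / (2 * ξ) - u * x = (ξ * x - u) ^ 2 / (2 * ξ) := by
        field_simp; ring
      nlinarith [div_nonneg (sq_nonneg (ξ * x - u)) (by linarith : 0 ≤ 2 * ξ)]
    simpa [mul_pow] using key |b j - b' j| (|r - r'| * |v j|)
  have h3 : ∑ j ∈ E, |b j - b' j| ^ 2 ≤ ∑ j, (b - b') j ^ 2 := by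
    simp only [sq_abs, Pi.sub_apply]
    exact Finset.sum_le_sum_of_subset_of_nonneg (Finset.subset_univ E) fun _ _ _ => sq_nonneg _
  rw [Finset.sum_add_distrib, ← Finset.mul_sum, ← Finset.sum_div, ← Finset.mul_sum] at h2
  set V := ∑ j ∈ E, v j ^ 2
  have h4 : (b j - b' j) ^ 2 ≤ ∑ j, (b - b') j ^ 2 :=
    Finset.single_le_sum (f := fun j => (b - b') j ^ 2) (fun j _ => sq_nonneg _)
      (Finset.mem_univ j)
  have hV : 0 ≤ V := Finset.sum_nonneg fun j _ => sq_nonneg _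
  have h5 : ξ / 2 * (b j - b' j) ^ 2 ≤ |r - r'| ^ 2 * V / (2 * ξ) := by
    nlinarith
  have h6 : (b j - b' j) ^ 2 ≤ (Real.sqrt V / ξ * |r - r'|) ^ 2 := by
    rw [mul_pow, div_pow, Real.sq_sqrt hV]
    calc (b j - b' j) ^ 2 = 2 / ξ * (ξ / 2 * (b j - b' j) ^ 2) := by field_simp
      _ ≤ 2 / ξ * (|r - r'| ^ 2 * V / (2 * ξ)) := mul_le_mul_of_nonneg_left h5 (by positivity)
      _ = V / ξ ^ 2 * |r - r'| ^ 2 := by field_simp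
  exact abs_le_of_sq_le_sq h6 (by positivity)

end WeightedLasso

/-! ### Existence of the path of a step -/

section StepPath

variable {n p : ℕ} {X : Matrix (Fin n) (Fin p) ℝ} {y : Fin n → ℝ} {ξ : ℝ}
  {E : Finset (Fin p)}

lemma colsOn_gram_mulVec {A : Finset (Fin p)} {x : Fin p → ℝ} (hx : ∀ j ∉ A, x j = 0) :
    ((colsOn X A)ᵀ * colsOn X A) *ᵥ (fun j : A => x j)
      = fun j : A => (Xᵀ *ᵥ (X *ᵥ x)) j := by
  have h : colsOn X A *ᵥ (fun j : A => x j) = X *ᵥ x := by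
    funext i
    simp only [Matrix.mulVec, dotProduct, colsOn, Matrix.submatrix_apply, id]
    rw [Finset.sum_coe_sort A fun j => X i j * x j]
    exact Finset.sum_subset (Finset.subset_univ A) fun j _ hj => by simp [hx j hj]
  rw [← Matrix.mulVec_mulVec, h]
  rfl

/-- A vector supported on `A` that solves the normal equations on `A` is the direction of `A`. -/
lemma isDirection_of_gram_eq {A : Finset (Fin p)} (hA : IsRestrictedConvex X ξ A) (hξ : 0 < ξ)
    {c h : Fin p → ℝ} (hh : ∀ j ∉ A, h j = 0) (hG : ∀ j ∈ A, (Xᵀ *ᵥ (X *ᵥ h)) j = c j) :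
    IsDirection X c A h := by
  have hu : IsUnit ((colsOn X A)ᵀ * colsOn X A) := by
    rw [← Matrix.mulVec_injective_iff_isUnit]
    refine (injective_iff_map_eq_zero (Matrix.mulVecLin _)).2 fun u hu => ?_
    set x : Fin p → ℝ := fun j => if hj : j ∈ A then u ⟨j, hj⟩ else 0 with hx
    have hx0 : ∀ j ∉ A, x j = 0 := fun j hj => by simp [hx, hj]
    have hxu : (fun j : A => x j) = u := by funext j; simp [hx]
    have h1 := colsOn_gram_mulVec (X := X) hx0
    rw [hxu, ← Matrix.mulVecLin_apply, hu] at h1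
    have h2 := hA.eq_zero hξ hx0 fun j hj => (congrFun h1 ⟨j, hj⟩).symm
    rw [← hxu, h2]; rfl
  have hd := (Matrix.isUnit_iff_isUnit_det _).1 hu
  refine ⟨hd, ?_, hh⟩
  have h1 : (fun j : A => c j) = ((colsOn X A)ᵀ * colsOn X A) *ᵥ (fun j : A => h j) := by
    rw [colsOn_gram_mulVec hh]
    funext j; exact (hG j j.2).symm
  rw [h1, Matrix.mulVec_mulVec, Matrix.nonsing_inv_mul _ hd, Matrix.one_mulVec]

/-- Two weighted Lasso solutions with the same sign pattern can be interpolated linearly. -/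
lemma IsWeightedLasso.convexComb {v b b' : Fin p → ℝ} {r r' θ : ℝ}
    (h : IsWeightedLasso X y E (r • v) b) (h' : IsWeightedLasso X y E (r' • v) b')
    (hs : ∀ j, SignType.sign (b j) = SignType.sign (b' j)) (h0 : 0 ≤ θ) (h1 : θ ≤ 1) :
    IsWeightedLasso X y E (((1 - θ) * r + θ * r') • v) ((1 - θ) • b + θ • b') ∧
      ∀ j, SignType.sign (((1 - θ) • b + θ • b') j) = SignType.sign (b j) := by
  have h1' : 0 ≤ 1 - θ := by linarith
  have hc : ∀ j, corr X y ((1 - θ) • b + θ • b') j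
      = (1 - θ) * corr X y b j + θ * corr X y b' j := fun j => by
    have : y - X *ᵥ ((1 - θ) • b + θ • b') = (1 - θ) • (y - X *ᵥ b) + θ • (y - X *ᵥ b') := by
      rw [Matrix.mulVec_add, Matrix.mulVec_smul, Matrix.mulVec_smul]
      module
    rw [corr, this, Matrix.mulVec_add, Matrix.mulVec_smul, Matrix.mulVec_smul]
    rfl
  refine ⟨⟨fun j hj => by simp [h.1 j hj, h'.1 j hj], fun j hj => ?_⟩, fun j => ?_⟩
  · obtain ⟨ha, hb⟩ := h.2 j hj
    obtain ⟨ha', hb'⟩ := h'.2 j hj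
    have hsj := hs j
    rw [hc]
    simp only [Pi.smul_apply, Pi.add_apply, smul_eq_mul] at ha hb ha' hb' ⊢
    constructor
    · calc |(1 - θ) * corr X y b j + θ * corr X y b' j|
          ≤ |(1 - θ) * corr X y b j| + |θ * corr X y b' j| := abs_add_le _ _
        _ = (1 - θ) * |corr X y b j| + θ * |corr X y b' j| := by
          rw [abs_mul, abs_mul, abs_of_nonneg h0, abs_of_nonneg h1']
        _ ≤ _ := by
          nlinarith [mul_le_mul_of_nonneg_left ha h1', mul_le_mul_of_nonneg_left ha' h0]
    · rcases lt_trichotomy (b j) 0 with hbj | hbj | hbj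
      · have hbj' : b' j < 0 := by rwa [← sign_eq_neg_one_iff, ← hsj, sign_eq_neg_one_iff]
        rw [abs_of_neg hbj] at hb
        rw [abs_of_neg hbj'] at hb'
        have e : corr X y b j = -(r * v j) := mul_right_cancel₀ hbj.ne (by linarith)
        have e' : corr X y b' j = -(r' * v j) := mul_right_cancel₀ hbj'.ne (by linarith)
        rw [abs_of_nonpos (by nlinarith), e, e']; ring
      · have hbj' : b' j = 0 := by rwa [← sign_eq_zero_iff, ← hsj, sign_eq_zero_iff]
        simp [hbj, hbj']
      · have hbj' : 0 < b' j := by rwa [← sign_eq_one_iff, ← hsj, sign_eq_one_iff]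
        rw [abs_of_pos hbj] at hb
        rw [abs_of_pos hbj'] at hb'
        have e : corr X y b j = r * v j := mul_right_cancel₀ hbj.ne' (by linarith)
        have e' : corr X y b' j = r' * v j := mul_right_cancel₀ hbj'.ne' (by linarith)
        rw [abs_of_nonneg (by positivity), e, e']; ring
  · have hsj := hs j
    simp only [Pi.smul_apply, Pi.add_apply, smul_eq_mul]
    rcases lt_trichotomy (b j) 0 with hbj | hbj | hbj
    · have hbj' : b' j < 0 := by rwa [← sign_eq_neg_one_iff, ← hsj, sign_eq_neg_one_iff]
      rw [sign_neg hbj, sign_eq_neg_one_iff]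
      rcases h0.eq_or_lt with rfl | h0
      · simpa using hbj
      · nlinarith
    · have hbj' : b' j = 0 := by rwa [← sign_eq_zero_iff, ← hsj, sign_eq_zero_iff]
      simp [hbj, hbj']
    · have hbj' : 0 < b' j := by rwa [← sign_eq_one_iff, ← hsj, sign_eq_one_iff]
      rw [sign_pos hbj, sign_eq_one_iff]
      rcases h0.eq_or_lt with rfl | h0
      · simpa using hbj
      · nlinarith

lemma eq_zero_left_of_continuousOn {f : ℝ → ℝ} {a b : ℝ} (hab : a < b)
    (hf : ContinuousOn f (Set.Icc a b)) (h : ∀ s ∈ Set.Ioc a b, f s = 0) : f a = 0 := by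
  have h1 : Tendsto f (𝓝[Set.Ioc a b] a) (𝓝 (f a)) :=
    (hf a ⟨le_rfl, hab.le⟩).mono_left (nhdsWithin_mono _ Set.Ioc_subset_Icc_self)
  have h2 : Tendsto f (𝓝[Set.Ioc a b] a) (𝓝 0) :=
    tendsto_const_nhds.congr' (by filter_upwards [self_mem_nhdsWithin] with s hs using (h s hs).symm)
  have : (𝓝[Set.Ioc a b] a).NeBot := by
    rw [nhdsWithin_Ioc_eq_nhdsGT hab]; infer_instance
  exact tendsto_nhds_unique h1 h2

/-- Along the path of weighted Lasso solutions the sign pattern is constant on some interval to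
the right of each time: the times with a given pattern form an interval, and there are only
finitely many patterns. -/
lemma exists_sign_const_right (hE : IsRestrictedConvex X ξ E) (hξ : 0 < ξ) {v : Fin p → ℝ}
    {g : ℝ → Fin p → ℝ} (hg : ∀ s ∈ Set.Icc (0 : ℝ) 1, IsWeightedLasso X y E ((1 - s) • v) (g s))
    {γ : ℝ} (hγ : γ ∈ Set.Ico (0 : ℝ) 1) :
    ∃ τ : Fin p → SignType, ∃ η ∈ Set.Ioc γ 1, ∀ s ∈ Set.Ioc γ η,
      ∀ j, SignType.sign (g s j) = τ j := by
  have h1 : ∃ τ : Fin p → SignType, ∃ᶠ s in 𝓝[>] γ, ∀ j, SignType.sign (g s j) = τ j := by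
    by_contra! h
    obtain ⟨s, hs⟩ := (eventually_all.2 h).exists
    obtain ⟨j, hj⟩ := hs fun j => SignType.sign (g s j)
    exact hj rfl
  obtain ⟨τ, hτ⟩ := h1
  obtain ⟨η, hητ, hη⟩ := (hτ.and_eventually (Ioc_mem_nhdsGT hγ.2)).exists
  refine ⟨τ, η, hη, fun s hs => ?_⟩
  obtain ⟨s', hs'τ, hs'⟩ := (hτ.and_eventually (Ioc_mem_nhdsGT hs.1)).exists
  rcases hs'.2.eq_or_lt with rfl | hlt
  · exact hs'τ
  have hpos : 0 < η - s' := by linarith [hs.2]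
  set θ := (s - s') / (η - s') with hθ
  have hθ0 : 0 ≤ θ := div_nonneg (by linarith) hpos.le
  have hθ1 : θ ≤ 1 := (div_le_one hpos).2 (by linarith [hs.2])
  have hmem : ∀ u, γ < u → u ≤ η → u ∈ Set.Icc (0 : ℝ) 1 := fun u h h' =>
    ⟨by linarith [hγ.1], by linarith [hη.2]⟩
  obtain ⟨hl, hsg⟩ := (hg s' (hmem s' hs'.1 (by linarith [hs.2]))).convexComb
    (hg η (hmem η hη.1 le_rfl)) (fun j => by rw [hs'τ, hητ]) hθ0 hθ1
  have hw : (1 - θ) * (1 - s') + θ * (1 - η) = 1 - s := by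
    have : θ * (η - s') = s - s' := div_mul_cancel₀ _ hpos.ne'
    linarith
  rw [hw] at hl
  rw [(hg s (hmem s hs.1 hs.2)).unique hE hξ hl]
  intro j; rw [hsg, hs'τ]

/-- The weighted Lasso solutions with weights `(1 - γ) v` form the path of a step. -/
lemma exists_isStepPath (hX : ∀ j, ∑ i, X i j ^ 2 = 1) (hE : IsRestrictedConvex X ξ E)
    (hξ : 0 < ξ) {v b : Fin p → ℝ} (hb : IsWeightedLasso X y E v b) :
    ∃ g : ℝ → Fin p → ℝ, IsStepPath X y E v b g ∧
      ∀ s ∈ Set.Icc (0 : ℝ) 1, IsWeightedLasso X y E ((1 - s) • v) (g s) := by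
  have hex : ∀ s : ℝ, ∃ b', s ∈ Set.Icc (0 : ℝ) 1 → IsWeightedLasso X y E ((1 - s) • v) b' := by
    intro s
    by_cases hs : s ∈ Set.Icc (0 : ℝ) 1
    · obtain ⟨b', hb'⟩ := exists_isWeightedLasso hX hE hξ y (v := (1 - s) • v) fun j hj =>
        mul_nonneg (by linarith [hs.2]) ((abs_nonneg _).trans (hb.2 j hj).1)
      exact ⟨b', fun _ => hb'⟩
    · exact ⟨0, fun h => absurd h hs⟩
  choose g hg using hex
  have hcont : ContinuousOn g (Set.Icc 0 1) := by
    rw [continuousOn_pi]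
    intro j
    refine (LipschitzOnWith.of_dist_le_mul (K := Real.toNNReal (Real.sqrt (∑ j ∈ E, v j ^ 2) / ξ))
      fun s hs t ht => ?_).continuousOn
    rw [Real.coe_toNNReal _ (by positivity), Real.dist_eq, Real.dist_eq, abs_sub_comm s t]
    have := (hg s hs).abs_sub_le hE hξ (hg t ht) j
    rwa [show (1 - s) - (1 - t) = t - s by ring] at this
  refine ⟨g, ⟨?_, hcont, fun γ hγ => ?_⟩, hg⟩
  · exact (hg 0 (by simp)).unique hE hξ (by simpa using hb)
  obtain ⟨τ, η, hη, hτ⟩ := exists_sign_const_right hE hξ hg hγ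
  have hsub : Set.Icc γ η ⊆ Set.Icc 0 1 := Set.Icc_subset_Icc hγ.1 hη.2
  have hgj : ∀ j, ContinuousOn (fun s => g s j) (Set.Icc γ η) := fun j =>
    (continuousOn_pi.1 hcont j).mono hsub
  have hcj : ∀ j, ContinuousOn (fun s => corr X y (g s) j) (Set.Icc γ η) := fun j => by
    have h1 : Continuous fun b' : Fin p → ℝ => corr X y b' j := by
      unfold corr; fun_prop
    exact h1.comp_continuousOn (hcont.mono hsub)
  have hext : ∀ f : ℝ → ℝ, ContinuousOn f (Set.Icc γ η) → (∀ s ∈ Set.Ioc γ η, f s = 0) →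
      ∀ s ∈ Set.Icc γ η, f s = 0 := fun f hf h s hs => by
    rcases hs.1.eq_or_lt with rfl | hlt
    · exact eq_zero_left_of_continuousOn hη.1 hf h
    · exact h s ⟨hlt, hs.2⟩
  -- the active set consists of the variables that are nonzero just after time `γ`
  set A := E.filter fun j => τ j ≠ 0 with hA
  have hAE : A ⊆ E := Finset.filter_subset _ _
  have hgA : ∀ j ∉ A, ∀ s ∈ Set.Icc γ η, g s j = 0 := fun j hj => by
    refine hext _ (hgj j) fun s hs => ?_
    by_cases hjE : j ∈ E
    · have : τ j = 0 := by by_contra h; exact hj (Finset.mem_filter.2 ⟨hjE, h⟩)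
      rw [← sign_eq_zero_iff, hτ s hs j, this]
    · exact (hg s (hsub ⟨hs.1.le, hs.2⟩)).1 j hjE
  have hτg : ∀ j, ∀ s ∈ Set.Icc γ η, (τ j : ℝ) * g s j - |g s j| = 0 := fun j => by
    refine hext _ ((continuousOn_const.mul (hgj j)).sub (hgj j).abs) fun s hs => ?_
    rw [← hτ s hs j, sign_mul_self, sub_self]
  have hcA : ∀ j ∈ A, ∀ s ∈ Set.Icc γ η, corr X y (g s) j = (1 - s) * (v j * τ j) := by
    intro j hj s hs
    rw [← sub_eq_zero]
    refine hext (fun s => corr X y (g s) j - (1 - s) * (v j * τ j)) ((hcj j).sub (by fun_prop))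
      (fun s hs => ?_) s hs
    have h1 := ((hg s (hsub ⟨hs.1.le, hs.2⟩)).2 j (hAE hj)).2
    have h2 : g s j ≠ 0 := by
      rw [← sign_ne_zero, hτ s hs j]; exact (Finset.mem_filter.1 hj).2
    rw [← sign_mul_self (g s j), hτ s hs j] at h1
    simp only [Pi.smul_apply, smul_eq_mul] at h1
    rw [sub_eq_zero]
    exact mul_right_cancel₀ h2 (by linarith)
  have hγ1 : 0 < 1 - γ := by linarith [hγ.2]
  have hηγ : 0 < η - γ := by linarith [hη.1]
  have hτ1 : ∀ j ∈ A, |(τ j : ℝ)| = 1 := fun j hj => by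
    have := (Finset.mem_filter.1 hj).2
    cases h : τ j <;> simp_all
  have hγmem : γ ∈ Set.Icc γ η := ⟨le_rfl, hη.1.le⟩
  have hηmem : η ∈ Set.Icc γ η := ⟨hη.1.le, le_rfl⟩
  have hG : ∀ s ∈ Set.Icc γ η, ∀ j ∈ A,
      (Xᵀ *ᵥ (X *ᵥ (g s - g γ))) j = (s - γ) * (v j * τ j) := fun s hs j hj => by
    rw [← corr_sub_corr X y, hcA j hj γ hγmem, hcA j hj s hs]; ring
  have hGs : ∀ (r : ℝ) (x : Fin p → ℝ) (j : Fin p),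
      (Xᵀ *ᵥ (X *ᵥ (r • x))) j = r * (Xᵀ *ᵥ (X *ᵥ x)) j := fun r x j => by
    simp [Matrix.mulVec_smul]
  set h := ((1 - γ) / (η - γ)) • (g η - g γ) with hh
  refine ⟨A, hAE, h, η, hη, ?_, fun s hs => ?_, fun j hj => ⟨?_, fun s hs => ?_⟩,
    fun j hj => ⟨?_, fun s hs => ?_⟩⟩
  · refine isDirection_of_gram_eq (hE.mono hAE) hξ (fun j hj => ?_) fun j hj => ?_
    · simp [hh, hgA j hj γ hγmem, hgA j hj η hηmem]
    · rw [hh, hGs, hG η hηmem j hj, hcA j hj γ hγmem]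
      field_simp
  · have hz := (hE.mono hAE).eq_zero hξ
      (x := (g s - g γ) - ((s - γ) / (η - γ)) • (g η - g γ))
      (fun j hj => by simp [hgA j hj γ hγmem, hgA j hj η hηmem, hgA j hj s hs])
      (fun j hj => by
        rw [Matrix.mulVec_sub, Matrix.mulVec_sub, Pi.sub_apply, hGs, hG s hs j hj,
          hG η hηmem j hj]
        field_simp
        ring)
    have e : ((s - γ) / (1 - γ)) • h = ((s - γ) / (η - γ)) • (g η - g γ) := by
      rw [hh, smul_smul]; congr 1; field_simp
    rw [e, ← sub_eq_zero.1 hz]; abel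
  · rw [hcA j hj γ hγmem, abs_mul, abs_mul, hτ1 j hj, mul_one, abs_of_pos hγ1,
      abs_of_nonneg ((abs_nonneg _).trans (hb.2 j (hAE hj)).1)]
  · rw [hcA j hj γ hγmem]
    have h1 : (τ j : ℝ) * g s j = |g s j| := by linarith [hτg j s hs]
    rw [mul_assoc, mul_assoc, h1]
    exact mul_nonneg hγ1.le (mul_nonneg ((abs_nonneg _).trans (hb.2 j (hAE hj)).1) (abs_nonneg _))
  · exact hgA j (Finset.mem_sdiff.1 hj).2 γ hγmem
  · exact ((hg s (hsub hs)).2 j (Finset.mem_sdiff.1 hj).1).1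

end StepPath

/-! ### Invariants of a run of FLASH -/

section Invariants

variable {n p : ℕ} {X : Matrix (Fin n) (Fin p) ℝ} {y : Fin n → ℝ} {E : Finset (Fin p)}
  {v b : Fin p → ℝ} {g : ℝ → Fin p → ℝ}

lemma continuous_corr_apply (X : Matrix (Fin n) (Fin p) ℝ) (y : Fin n → ℝ) (j : Fin p) :
    Continuous fun b : Fin p → ℝ => corr X y b j := by
  unfold corr; fun_prop

/-- At time `1` this follows by continuity: all correlations of entered variables are zero. -/
lemma IsStepPath.abs_corr_le (h : IsStepPath X y E v b g) {γ : ℝ} (hγ : γ ∈ Set.Icc (0 : ℝ) 1)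
    {j : Fin p} (hj : j ∈ E) : |corr X y (g γ) j| ≤ (1 - γ) * v j := by
  have hlt : ∀ γ ∈ Set.Ico (0 : ℝ) 1, |corr X y (g γ) j| ≤ (1 - γ) * v j := fun γ hγ => by
    obtain ⟨A, _, _, η, hη, _, _, hA, hEA⟩ := h.move γ hγ
    by_cases hjA : j ∈ A
    · exact (hA j hjA).1.le
    · exact (hEA j (Finset.mem_sdiff.2 ⟨hj, hjA⟩)).2 γ ⟨le_rfl, hη.1.le⟩
  refine (?_ : ∀ γ ∈ Set.Icc (0 : ℝ) 1, |corr X y (g γ) j| ≤ (1 - γ) * v j) γ hγ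
  rw [← closure_Ico zero_ne_one]
  have hc : ContinuousOn (fun γ => |corr X y (g γ) j|) (Set.Icc (0 : ℝ) 1) :=
    ((continuous_corr_apply X y j).comp_continuousOn h.cont).abs
  rw [← closure_Ico zero_ne_one] at hc
  exact fun γ hγ => le_on_closure hlt hc (by fun_prop) hγ

/-- The coefficient of a variable that has not entered does not move, since its right derivative
vanishes at every time. -/
lemma IsStepPath.eq_of_notMem (h : IsStepPath X y E v b g) {γ : ℝ} (hγ : γ ∈ Set.Icc (0 : ℝ) 1)
    {j : Fin p} (hj : j ∉ E) : g γ j = b j := by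
  have h1 := constant_of_has_deriv_right_zero (f := fun s => g s j)
    (continuousOn_pi.1 h.cont j) (fun s hs => ?_) γ hγ
  · rw [← h.start]; exact h1
  · obtain ⟨A, hAE, d, η, hη, hd, hlin, _⟩ := h.move s hs
    refine (hasDerivWithinAt_const s (Set.Ici s) (g s j)).congr_of_eventuallyEq ?_ rfl
    filter_upwards [Icc_mem_nhdsGE hη.1] with u hu
    rw [hlin u hu]
    simp [hd.2.2 j fun hA => hj (hAE hA)]

/-- Facts that hold after `l` steps of every run of block FLASH.  By `dominated`, a variable with
the largest absolute correlation among those that have not entered has the largest absolute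
correlation of all. -/
structure RunInvariant {n p : ℕ} (X : Matrix (Fin n) (Fin p) ℝ) (y : Fin n → ℝ)
    (l : ℕ) (b : Fin p → ℝ) (E : Finset (Fin p)) (v : Fin p → ℝ) : Prop where
  card : E.card = l
  supp : ∀ j ∉ E, b j = 0
  corr_le : ∀ j ∈ E, |corr X y b j| ≤ v j
  dominated : ∀ i ∈ E, v i ≤ 0 ∨ ∃ j ∉ E, v i ≤ |corr X y b j|

lemma RunInvariant.abs_corr_le {l : ℕ} (h : RunInvariant X y l b E v) {k : Fin p}
    (hk : ∀ j, j ∉ E → |corr X y b j| ≤ |corr X y b k|) (j : Fin p) :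
    |corr X y b j| ≤ |corr X y b k| := by
  by_cases hj : j ∈ E
  · rcases h.dominated j hj with h1 | ⟨i, hi, h1⟩
    · exact ((h.corr_le j hj).trans h1).trans (abs_nonneg _)
    · exact ((h.corr_le j hj).trans h1).trans (hk i hi)
  · exact hk j hj

lemma blockDelta_eq (lstar l : ℕ) : blockDelta lstar l = 0 ∨ blockDelta lstar l = 1 := by
  unfold blockDelta; split_ifs <;> simp

lemma stepLength_mem {γL δ : ℝ} (hL : γL ∈ Set.Icc (0 : ℝ) 1) (hδ : δ = 0 ∨ δ = 1) :
    γL + δ * (1 - γL) ∈ Set.Icc (0 : ℝ) 1 := by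
  rcases hδ with rfl | rfl
  · simpa using hL
  · simp

lemma FlashRun.runInvariant {lstar l : ℕ} (h : FlashRun X y (blockDelta lstar) l b E v) :
    RunInvariant X y l b E v := by
  induction h with
  | init => exact ⟨rfl, by simp, by simp, by simp⟩
  | step l b E v k g γL γ run not_done new maximal path lasso stepsize ih =>
    have hγ : γ ∈ Set.Icc (0 : ℝ) 1 := stepsize ▸ stepLength_mem lasso.1.1 (blockDelta_eq _ _)
    refine ⟨?_, fun j hj => ?_, fun j hj => ?_, fun i hi => ?_⟩
    · rw [Finset.card_insert_of_notMem new, ih.card]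
    · rw [path.eq_of_notMem hγ hj]
      exact ih.supp j fun h => hj (Finset.mem_insert_of_mem h)
    · exact path.abs_corr_le hγ hj
    · have h1 : γ = 1 ∨ γ = γL := by
        rcases blockDelta_eq lstar (l + 1) with h | h <;> rw [h] at stepsize
        · right; linarith
        · left; linarith
      rcases h1 with rfl | rfl
      · left; simp
      · rcases lasso.1.2 with h1 | ⟨j, hj, h1⟩
        · left; simp [h1]
        · exact Or.inr ⟨j, hj, h1 i hi⟩

end Invariants

/-! ### Block FLASH when the noise is bounded -/

/-- The variables with a nonzero coefficient. -/
noncomputable def signalSet {p : ℕ} (β : Fin p → ℝ) : Finset (Fin p) := Finset.univ.filter fun j => β j ≠ 0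

/-- The variables whose coefficient exceeds that of `b` in absolute value. -/
noncomputable def aboveSet {p : ℕ} (β : Fin p → ℝ) (b : Fin p) : Finset (Fin p) :=
  Finset.univ.filter fun j => |β b| < |β j|

/-- The variables whose coefficient is at least that of `a` in absolute value. -/
noncomputable def largeSet {p : ℕ} (β : Fin p → ℝ) (a : Fin p) : Finset (Fin p) :=
  Finset.univ.filter fun j => |β a| ≤ |β j|

/-- The variables whose coefficient is at least `21 |β_b| / ξ²` in absolute value.  This threshold
lies well above `|β_b|` and well below `|β_a|`; the number of these variables is the break point
of block FLASH. -/
noncomputable def midSet {p : ℕ} (β : Fin p → ℝ) (b : Fin p) (ξ : ℝ) : Finset (Fin p) :=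
  Finset.univ.filter fun j => 21 * |β b| ≤ ξ ^ 2 * |β j|

/-- The assumptions under which block FLASH recovers the signed support: the correlations of the
predictors with the noise are at most `N`, the coefficients are large compared with `N`, the
coefficients of `a` and `b` are well separated, and the coherence `μ` obeys the two bounds that
make up `muFlash`. -/
structure IsRecoverable {n p : ℕ} (X : Matrix (Fin n) (Fin p) ℝ) (y : Fin n → ℝ)
    (β : Fin p → ℝ) (a b : Fin p) (μ ξ N : ℝ) : Prop where
  incoherent : IsIncoherent X μ
  μ_nonneg : 0 ≤ μ
  ξ_pos : 0 < ξ
  ξ_lt_one : ξ < 1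
  N_nonneg : 0 ≤ N
  noise_le : ∀ j, |corr X y β j| ≤ N
  signal : ∀ j, β j ≠ 0 → 7 * N < ξ ^ 2 * |β j|
  small_ne_zero : β b ≠ 0
  separation : 60 * |β b| < ξ ^ 3 * |β a|
  coherence_above : μ * (2 * (aboveSet β b).card - 1) ≤ 1 - ξ
  coherence_large : μ * (2 * (signalSet β).card - (largeSet β a).card) ≤ 1 - ξ

namespace IsRecoverable

variable {n p : ℕ} {X : Matrix (Fin n) (Fin p) ℝ} {y : Fin n → ℝ} {β : Fin p → ℝ} {a b : Fin p}
  {μ ξ N : ℝ} {E : Finset (Fin p)} {x : Fin p → ℝ}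

lemma mid_subset_above (h : IsRecoverable X y β a b μ ξ N) : midSet β b ξ ⊆ aboveSet β b := by
  intro j hj
  have h1 := (Finset.mem_filter.1 hj).2
  have h2 : ξ ^ 2 ≤ 1 := pow_le_one₀ h.ξ_pos.le h.ξ_lt_one.le
  have h3 := abs_pos.2 h.small_ne_zero
  refine Finset.mem_filter.2 ⟨Finset.mem_univ _, ?_⟩
  nlinarith [mul_le_mul_of_nonneg_right h2 (abs_nonneg (β j))]

lemma above_subset_signal : aboveSet β b ⊆ signalSet β := fun _ hj =>
  Finset.mem_filter.2 ⟨Finset.mem_univ _,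
    abs_pos.1 ((abs_nonneg _).trans_lt (Finset.mem_filter.1 hj).2)⟩

lemma large_subset_mid (h : IsRecoverable X y β a b μ ξ N) :
    largeSet β a ⊆ midSet β b ξ := by
  intro j hj
  have h1 := (Finset.mem_filter.1 hj).2
  refine Finset.mem_filter.2 ⟨Finset.mem_univ _, ?_⟩
  have h2 : ξ ^ 3 * |β a| ≤ ξ ^ 2 * |β a| :=
    mul_le_mul_of_nonneg_right (pow_le_pow_of_le_one h.ξ_pos.le h.ξ_lt_one.le (by norm_num))
      (abs_nonneg _)
  have h3 := mul_le_mul_of_nonneg_left h1 (sq_nonneg ξ)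
  linarith [h.separation, abs_nonneg (β b)]

lemma mid_card_pos (h : IsRecoverable X y β a b μ ξ N) : 1 ≤ (midSet β b ξ).card :=
  Finset.card_pos.2 ⟨a, h.large_subset_mid (Finset.mem_filter.2 ⟨Finset.mem_univ _, le_rfl⟩)⟩

lemma mul_card_signal_le (h : IsRecoverable X y β a b μ ξ N) :
    μ * (signalSet β).card ≤ 1 - ξ := by
  have h1 : ((largeSet β a).card : ℝ) ≤ (signalSet β).card := by
    exact_mod_cast Finset.card_le_card
      ((h.large_subset_mid.trans h.mid_subset_above).trans above_subset_signal)
  nlinarith [h.coherence_large, mul_le_mul_of_nonneg_left h1 h.μ_nonneg]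

lemma isRestrictedConvex (h : IsRecoverable X y β a b μ ξ N) (hE : E ⊆ signalSet β) :
    IsRestrictedConvex X ξ E :=
  IsRestrictedConvex.mono (E := signalSet β) (fun _ hx => h.incoherent.mul_sum_sq_le h.μ_nonneg
    (by nlinarith [h.mul_card_signal_le, h.μ_nonneg]) hx) hE

/-- The first phase.  As long as a variable of `midSet` is missing, the largest absolute
correlation is so large that the coefficients up to `|β_b|` act as noise: only a variable of
`aboveSet` can enter, and even only one of `midSet` if some large variable is missing. -/
lemma first_phase (h : IsRecoverable X y β a b μ ξ N) (hE : E ⊆ aboveSet β b)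
    (hx : ∀ j ∉ E, x j = 0) {k : Fin p} (hk : k ∉ E)
    (hmax : ∀ j, |corr X y x j| ≤ |corr X y x k|) (hmid : ∃ j ∈ midSet β b ξ, j ∉ E) :
    k ∈ aboveSet β b ∧ corr X y x k ≠ 0 ∧
      ((∃ j ∈ largeSet β a, j ∉ E) → k ∈ midSet β b ξ) := by
  have hξ := h.ξ_pos
  have hξ1 := h.ξ_lt_one
  have hμ := h.μ_nonneg
  have hB := abs_pos.2 h.small_ne_zero
  set B := |β b|
  set lam := |corr X y x k| with hlam
  have hlam0 : 0 ≤ lam := abs_nonneg _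
  set β₂ : Fin p → ℝ := fun j => if j ∈ aboveSet β b then 0 else β j with hβ₂
  set d : Fin p → ℝ := fun j => (if j ∈ aboveSet β b then β j else 0) - x j with hd
  set w : Fin p → ℝ := Xᵀ *ᵥ (X *ᵥ β₂) + corr X y β with hw
  have hcd : corr X y x = Xᵀ *ᵥ (X *ᵥ d) + w := by
    rw [corr_eq_add X y x β, hw, ← add_assoc, ← Matrix.mulVec_add, ← Matrix.mulVec_add]
    congr 3
    funext j
    simp only [hd, hβ₂, Pi.add_apply, Pi.sub_apply]
    split_ifs <;> ring_nf
  have hd0 : ∀ j ∉ aboveSet β b, d j = 0 := fun j hj => by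
    simp [hd, hj, hx j fun hjE => hj (hE hjE)]
  have hSμ := h.mul_card_signal_le
  have hNB : N ≤ B := by
    have h1 := h.signal b h.small_ne_zero
    have h2 : ξ ^ 2 ≤ 1 := pow_le_one₀ hξ.le hξ1.le
    nlinarith [h.N_nonneg]
  have hβ₂B : ∀ j, |β₂ j| ≤ B := fun j => by
    by_cases hj : j ∈ aboveSet β b
    · simp [hβ₂, hj, hB.le]
    · simp only [hβ₂, hj, if_false]
      by_contra! hlt
      exact hj (Finset.mem_filter.2 ⟨Finset.mem_univ _, hlt⟩)
  have hβ₂sum : ∑ j, |β₂ j| ≤ (signalSet β).card * B := by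
    rw [← Finset.sum_subset (Finset.subset_univ (signalSet β)), ← nsmul_eq_mul]
    · exact Finset.sum_le_card_nsmul _ _ _ fun j _ => hβ₂B j
    · intro j _ hj
      have : β j = 0 := by
        by_contra h0; exact hj (Finset.mem_filter.2 ⟨Finset.mem_univ _, h0⟩)
      simp [hβ₂, this]
  have hwB : ∀ j, |w j| ≤ 3 * B := fun j => by
    have e : w j = ((Xᵀ *ᵥ (X *ᵥ β₂)) j - β₂ j) + β₂ j + corr X y β j := by simp [hw]
    have h1 := h.incoherent.abs_gram_sub_le β₂ j
    have h2 : μ * (∑ i, |β₂ i| - |β₂ j|) ≤ B := by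
      have := mul_le_mul_of_nonneg_left hβ₂sum hμ
      nlinarith [mul_nonneg hμ (abs_nonneg (β₂ j))]
    rw [e]
    refine (abs_add_three _ _ _).trans ?_
    linarith [hβ₂B j, h.noise_le j]
  have hcard : ((aboveSet β b).card : ℝ) ≤ (signalSet β).card := by
    exact_mod_cast Finset.card_le_card above_subset_signal
  have key : ∀ j, ξ * |corr X y x j - d j| ≤ ξ * (1 - ξ) * lam + 6 * B := fun j => by
    have h1 := h.incoherent.abs_corr_sub_le hξ hξ1 hμ (Finset.empty_subset (aboveSet β b))
      (by rw [Finset.sdiff_empty]; linarith [h.coherence_above])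
      (by nlinarith [mul_le_mul_of_nonneg_left hcard hμ]) hcd hd0 hwB (by linarith) hlam0
      (fun j _ => hmax j) (by simp) j
    have h2 := mul_le_mul_of_nonneg_left h1 hξ.le
    have h3 : ξ * ((1 - ξ) * lam + 2 * (3 * B) / ξ) = ξ * (1 - ξ) * lam + 6 * B := by
      field_simp; ring
    linarith
  -- a missing variable of `aboveSet` keeps the largest correlation high
  have hmiss : ∀ j ∈ aboveSet β b, j ∉ E → ξ * |β j| ≤ 2 * ξ * lam + 6 * B := fun j hj hjE => by
    have h1 := key j
    have h2 : d j = β j := by simp [hd, hj, hx j hjE]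
    rw [h2] at h1
    have h3 : |β j| ≤ |corr X y x j| + |corr X y x j - β j| := by
      have := abs_sub_abs_le_abs_sub (β j) (corr X y x j)
      rw [abs_sub_comm] at this; linarith
    have h4 := mul_le_mul_of_nonneg_left (h3.trans (add_le_add_left (hmax j) _)) hξ.le
    nlinarith [mul_nonneg (sq_nonneg ξ) hlam0]
  obtain ⟨m, hm, hmE⟩ := hmid
  have hm1 := hmiss m (h.mid_subset_above hm) hmE
  have hm2 : 21 * B ≤ ξ ^ 2 * |β m| := (Finset.mem_filter.1 hm).2
  have hm3 : 21 * B ≤ 2 * (ξ ^ 2 * lam) + 6 * B := by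
    nlinarith [mul_le_mul_of_nonneg_left hm1 hξ.le]
  have hk1 : k ∈ aboveSet β b := by
    by_contra hk1
    have h1 := key k
    rw [hd0 k hk1, sub_zero, ← hlam] at h1
    nlinarith
  refine ⟨hk1, ?_, ?_⟩
  · intro h0
    rw [h0, abs_zero] at hlam
    rw [hlam] at hm3
    linarith
  · rintro ⟨j, hj, hjE⟩
    have h1 := hmiss j (h.mid_subset_above (h.large_subset_mid hj)) hjE
    have h2 := mul_le_mul_of_nonneg_left (Finset.mem_filter.1 hj).2 (pow_nonneg hξ.le 3)
    have h3 := h.separation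
    have h4 := mul_le_mul_of_nonneg_left h1 (sq_nonneg ξ)
    have h5 : ξ ^ 2 ≤ 1 := pow_le_one₀ hξ.le hξ1.le
    have h6 := mul_le_mul_of_nonneg_right h5 hB.le
    have h7 : 27 * B < ξ ^ 3 * lam := by nlinarith
    have h8 := key k
    have h9 : d k = β k := by simp [hd, hk1, hx k hk]
    rw [h9] at h8
    have h10 : lam ≤ |β k| + |corr X y x k - β k| := by
      have := abs_sub_abs_le_abs_sub (corr X y x k) (β k)
      linarith
    have h11 : ξ ^ 2 * lam - 6 * B ≤ ξ * |β k| := by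
      nlinarith [mul_le_mul_of_nonneg_left h10 hξ.le]
    refine Finset.mem_filter.2 ⟨Finset.mem_univ _, ?_⟩
    nlinarith [mul_le_mul_of_nonneg_left h11 hξ.le]

/-- After the Forward step the correlations vanish on a set `F` containing the large variables,
and the correlations with the residual approximate the coefficient errors. -/
lemma second_phase (h : IsRecoverable X y β a b μ ξ N) (hE : E ⊆ signalSet β)
    (hx : ∀ j ∉ E, x j = 0) {F : Finset (Fin p)} (hF : F ⊆ E) (hL : largeSet β a ⊆ F)
    (hcF : ∀ j ∈ F, corr X y x j = 0) {lam : ℝ} (hlam : 0 ≤ lam)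
    (hmax : ∀ j ∈ signalSet β, |corr X y x j| ≤ lam) (j : Fin p) :
    ξ * |corr X y x j - (β j - x j)| ≤ ξ * (1 - ξ) * lam + 2 * N := by
  have hξ := h.ξ_pos
  have hd0 : ∀ j ∉ signalSet β, (β - x) j = 0 := fun j hj => by
    have : β j = 0 := by
      by_contra h0; exact hj (Finset.mem_filter.2 ⟨Finset.mem_univ _, h0⟩)
    simp [this, hx j fun hjE => hj (hE hjE)]
  have hcard : ((signalSet β \ F).card : ℝ) ≤ (signalSet β).card - (largeSet β a).card := by
    rw [Finset.cast_card_sdiff (hF.trans hE)]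
    have : ((largeSet β a).card : ℝ) ≤ F.card := by exact_mod_cast Finset.card_le_card hL
    linarith
  have h1 := h.incoherent.abs_corr_sub_le hξ h.ξ_lt_one h.μ_nonneg (hF.trans hE)
    (by nlinarith [h.coherence_large, mul_le_mul_of_nonneg_left hcard h.μ_nonneg, h.μ_nonneg])
    (by linarith [h.mul_card_signal_le]) (corr_eq_add X y x β) hd0 h.noise_le h.N_nonneg hlam
    hmax hcF j
  have h2 := mul_le_mul_of_nonneg_left h1 hξ.le
  have h3 : ξ * ((1 - ξ) * lam + 2 * N / ξ) = ξ * (1 - ξ) * lam + 2 * N := by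
    field_simp
  rw [Pi.sub_apply] at h2
  linarith

/-- In the second phase only signal variables enter while one of them is missing. -/
lemma second_phase_mem (h : IsRecoverable X y β a b μ ξ N) (hE : E ⊆ signalSet β)
    (hx : ∀ j ∉ E, x j = 0) {F : Finset (Fin p)} (hF : F ⊆ E) (hL : largeSet β a ⊆ F)
    (hcF : ∀ j ∈ F, corr X y x j = 0) {k : Fin p} (hk : k ∉ E)
    (hmax : ∀ j, |corr X y x j| ≤ |corr X y x k|) (hmiss : ∃ j ∈ signalSet β, j ∉ E) :
    k ∈ signalSet β ∧ corr X y x k ≠ 0 := by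
  have hξ := h.ξ_pos
  have hξ1 := h.ξ_lt_one
  have hN := h.N_nonneg
  have key := h.second_phase hE hx hF hL hcF (abs_nonneg _) fun j _ => hmax j
  set lam := |corr X y x k| with hlam
  have hlam0 : 0 ≤ lam := abs_nonneg _
  obtain ⟨m, hm, hmE⟩ := hmiss
  have h1 := key m
  rw [hx m hmE, sub_zero] at h1
  have h2 : |β m| ≤ lam + |corr X y x m - β m| := by
    have := abs_sub_abs_le_abs_sub (β m) (corr X y x m)
    rw [abs_sub_comm] at this; linarith [hmax m]
  have h3 : ξ * |β m| ≤ 2 * ξ * lam + 2 * N := by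
    nlinarith [mul_le_mul_of_nonneg_left h2 hξ.le, mul_nonneg (sq_nonneg ξ) hlam0]
  have h4 := h.signal m (Finset.mem_filter.1 hm).2
  have h5 : 7 * N < 2 * (ξ ^ 2 * lam) + 2 * N := by
    nlinarith [mul_le_mul_of_nonneg_left h3 hξ.le]
  constructor
  · by_contra hks
    have h6 := key k
    have h7 : β k = 0 := by
      by_contra h0; exact hks (Finset.mem_filter.2 ⟨Finset.mem_univ _, h0⟩)
    rw [hx k hk, h7, sub_zero, sub_zero, ← hlam] at h6
    nlinarith
  · intro h0
    rw [h0, abs_zero] at hlam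
    rw [hlam] at h5
    linarith

end IsRecoverable

/-! ### Existence and correctness of the block FLASH estimator -/

/-- The variables entered during the first phase lie in `aboveSet`, and in `midSet` until all large
ones have entered.  After the Forward step the prescribed correlations are zero on a set `F` of
entered variables that contains the large ones. -/
structure PhaseInvariant {p : ℕ} (β : Fin p → ℝ) (a b : Fin p) (ξ : ℝ) (l : ℕ)
    (E : Finset (Fin p)) (v : Fin p → ℝ) : Prop where
  first : l < (midSet β b ξ).card →
    E ⊆ aboveSet β b ∧ ((∃ j ∈ largeSet β a, j ∉ E) → E ⊆ midSet β b ξ)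
  second : (midSet β b ξ).card ≤ l →
    E ⊆ signalSet β ∧ ∃ F ⊆ E, largeSet β a ⊆ F ∧ ∀ j ∈ F, v j = 0

namespace IsRecoverable

variable {n p : ℕ} {X : Matrix (Fin n) (Fin p) ℝ} {y : Fin n → ℝ} {β : Fin p → ℝ} {a b : Fin p}
  {μ ξ N : ℝ} {E : Finset (Fin p)} {x v : Fin p → ℝ} {l : ℕ}

/-- The next variable to enter is a signal variable, and in the first phase it preserves the
invariant of that phase. -/
lemma next_variable (h : IsRecoverable X y β a b μ ξ N) (hr : RunInvariant X y l x E v)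
    (hp : PhaseInvariant β a b ξ l E v) (hl : l < (signalSet β).card) {k : Fin p} (hk : k ∉ E)
    (hmax : ∀ j, j ∉ E → |corr X y x j| ≤ |corr X y x k|) :
    insert k E ⊆ signalSet β ∧ corr X y x k ≠ 0 ∧
      (l < (midSet β b ξ).card → insert k E ⊆ aboveSet β b ∧
        ((∃ j ∈ largeSet β a, j ∉ insert k E) → insert k E ⊆ midSet β b ξ)) := by
  have hmax' := hr.abs_corr_le hmax
  rcases lt_or_ge l (midSet β b ξ).card with h1 | h1
  · obtain ⟨hE, hEm⟩ := hp.first h1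
    obtain ⟨hka, hck, hkm⟩ := h.first_phase hE hr.supp hk hmax'
      (Finset.exists_mem_notMem_of_card_lt_card (by rw [hr.card]; exact h1))
    have hins := Finset.insert_subset hka hE
    refine ⟨hins.trans above_subset_signal, hck, fun _ => ⟨hins, ?_⟩⟩
    rintro ⟨j, hj, hjE⟩
    have hjE' : j ∉ E := fun h => hjE (Finset.mem_insert_of_mem h)
    exact Finset.insert_subset (hkm ⟨j, hj, hjE'⟩) (hEm ⟨j, hj, hjE'⟩)
  · obtain ⟨hE, F, hF, hL, hv⟩ := hp.second h1
    have hcF : ∀ j ∈ F, corr X y x j = 0 := fun j hj => by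
      have := hr.corr_le j (hF hj)
      rw [hv j hj] at this
      exact abs_nonpos_iff.1 this
    obtain ⟨hks, hck⟩ := h.second_phase_mem hE hr.supp hF hL hcF hk hmax'
      (Finset.exists_mem_notMem_of_card_lt_card (by rw [hr.card]; exact hl))
    exact ⟨Finset.insert_subset hks hE, hck, fun h2 => absurd h1 (not_le.2 h2)⟩

lemma phaseInvariant (h : IsRecoverable X y β a b μ ξ N)
    (hrun : FlashRun X y (blockDelta (midSet β b ξ).card) l x E v)
    (hl : l ≤ (signalSet β).card) : PhaseInvariant β a b ξ l E v := by
  induction hrun with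
  | init => exact ⟨fun _ => by simp, fun h0 => absurd h.mid_card_pos (by omega)⟩
  | step l x E v k g γL γ run not_done new maximal path lasso stepsize ih =>
    have hp := ih (by omega)
    have hr := run.runInvariant
    obtain ⟨hins, -, hfirst⟩ := h.next_variable hr hp (by omega) new maximal
    refine ⟨fun hlt => hfirst (by omega), fun hge => ⟨hins, ?_⟩⟩
    rcases hge.eq_or_lt with heq | hlt
    · -- the Forward step; if a large variable were missing, the set of entered variables would be
      -- a subset of `midSet` of the same size, and so contain the large variables
      refine ⟨insert k E, subset_rfl, ?_, fun j _ => ?_⟩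
      · by_contra hL
        obtain ⟨j, hj, hjE⟩ := Finset.not_subset.1 hL
        have hcard : (insert k E).card = (midSet β b ξ).card := by
          rw [Finset.card_insert_of_notMem new, hr.card, heq]
        have := Finset.eq_of_subset_of_card_le
          ((hfirst (by omega)).2 ⟨j, hj, hjE⟩) hcard.ge
        exact hjE (this ▸ h.large_subset_mid hj)
      · have : γ = 1 := by
          rw [stepsize, blockDelta, if_pos heq.symm]; ring
        simp [this]
    · obtain ⟨-, F, hF, hL, hv⟩ := hp.second (by omega)
      refine ⟨F, hF.trans (Finset.subset_insert _ _), hL, fun j hj => ?_⟩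
      have : j ≠ k := fun e => new (e ▸ hF hj)
      simp [Function.update_of_ne this, hv j hj]

lemma exists_run (h : IsRecoverable X y β a b μ ξ N) (hl : l ≤ (signalSet β).card) :
    ∃ x E v, FlashRun X y (blockDelta (midSet β b ξ).card) l x E v ∧
      IsWeightedLasso X y E v x := by
  induction l with
  | zero => exact ⟨0, ∅, 0, FlashRun.init, by simp [IsWeightedLasso]⟩
  | succ l ih =>
    obtain ⟨x, E, v, hrun, hx⟩ := ih (by omega)
    have hr := hrun.runInvariant
    have hne : (Finset.univ \ E).Nonempty := by
      obtain ⟨j, -, hj⟩ := Finset.exists_mem_notMem_of_card_lt_card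
        (s := E) (t := signalSet β) (by rw [hr.card]; omega)
      exact ⟨j, by simp [hj]⟩
    obtain ⟨k, hkE, hkmax⟩ := Finset.exists_max_image _ (fun j => |corr X y x j|) hne
    have hk : k ∉ E := by simpa using hkE
    have hmax : ∀ j, j ∉ E → |corr X y x j| ≤ |corr X y x k| :=
      fun j hj => hkmax j (by simp [hj])
    obtain ⟨hins, hck, -⟩ := h.next_variable hr (h.phaseInvariant hrun (by omega))
      (by omega) hk hmax
    set E' := insert k E
    set v' := Function.update v k |corr X y x k|
    have hx' : IsWeightedLasso X y E' v' x := by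
      refine ⟨fun j hj => hx.1 j fun h => hj (Finset.mem_insert_of_mem h), fun j hj => ?_⟩
      rcases Finset.mem_insert.1 hj with rfl | hjE
      · simp [v', hx.1 j hk]
      · have : j ≠ k := fun e => hk (e ▸ hjE)
        simpa [v', Function.update_of_ne this] using hx.2 j hjE
    obtain ⟨g, hg, hgl⟩ := exists_isStepPath h.incoherent.norm_one
      (h.isRestrictedConvex hins) h.ξ_pos hx'
    obtain ⟨γL, hγL⟩ : ∃ γL, IsLassoDistance X y E' v' g γL := by
      refine IsCompact.exists_isLeast ?_ ⟨1, by simp⟩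
      have hc : ∀ j, ContinuousOn (fun γ => |corr X y (g γ) j|) (Set.Icc 0 1) := fun j =>
        ((continuous_corr_apply X y j).comp_continuousOn hg.cont).abs
      have hset : {γ : ℝ | γ ∈ Set.Icc (0 : ℝ) 1 ∧
          (γ = 1 ∨ ∃ j, j ∉ E' ∧ ∀ i ∈ E', (1 - γ) * v' i ≤ |corr X y (g γ) j|)}
          = {1} ∪ ⋃ j ∈ {j | j ∉ E'}, (Set.Icc 0 1 ∩ ⋂ i ∈ {i | i ∈ E'},
            {γ ∈ Set.Icc (0 : ℝ) 1 | (1 - γ) * v' i ≤ |corr X y (g γ) j|}) := by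
        ext γ
        simp only [Set.mem_ofPred_eq, Set.mem_union, Set.mem_singleton_iff, Set.mem_iUnion,
          Set.mem_inter_iff, Set.mem_iInter, exists_prop]
        constructor
        · rintro ⟨h1, h2 | ⟨j, hj, h2⟩⟩
          · exact Or.inl h2
          · exact Or.inr ⟨j, hj, h1, fun i hi => ⟨h1, h2 i hi⟩⟩
        · rintro (rfl | ⟨j, hj, h1, h2⟩)
          · simp
          · exact ⟨h1, Or.inr ⟨j, hj, fun i hi => (h2 i hi).2⟩⟩
      rw [hset]
      refine isCompact_singleton.union ((Set.toFinite _).isCompact_biUnion fun j _ =>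
        isCompact_Icc.inter_right (isClosed_biInter fun i _ => ?_))
      exact isClosed_Icc.isClosed_le (by fun_prop) (hc j)
    have hγ := stepLength_mem hγL.1.1 (blockDelta_eq (midSet β b ξ).card (l + 1))
    exact ⟨_, _, _, FlashRun.step l x E v k g γL _ hrun (fun h0 => hck (by rw [h0]; rfl)) hk hmax
      hg hγL rfl, hgl _ hγ⟩

/-- After as many steps as there are signal variables, the coefficients have the correct signs. -/
lemma recovers_of_run (h : IsRecoverable X y β a b μ ξ N)
    (hrun : FlashRun X y (blockDelta (midSet β b ξ).card) (signalSet β).card x E v) :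
    RecoversSignedSupport x β := by
  have hr := hrun.runInvariant
  obtain ⟨hE, F, hF, hL, hv⟩ := (h.phaseInvariant hrun le_rfl).second
    (Finset.card_le_card (h.mid_subset_above.trans above_subset_signal))
  have hEK : E = signalSet β := Finset.eq_of_subset_of_card_le hE hr.card.ge
  have hcF : ∀ j ∈ F, corr X y x j = 0 := fun j hj => by
    have := hr.corr_le j (hF hj)
    rw [hv j hj] at this
    exact abs_nonpos_iff.1 this
  have hξ := h.ξ_pos
  have hξ1 := h.ξ_lt_one
  have hN := h.N_nonneg
  have hzero : ∀ j ∉ signalSet β, β j = 0 ∧ x j = 0 := fun j hj =>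
    ⟨by by_contra h0; exact hj (Finset.mem_filter.2 ⟨Finset.mem_univ _, h0⟩),
      hr.supp j (hEK ▸ hj)⟩
  obtain ⟨i, hi, hmax⟩ := Finset.exists_max_image (signalSet β) (fun j => |corr X y x j|)
    ⟨b, Finset.mem_filter.2 ⟨Finset.mem_univ _, h.small_ne_zero⟩⟩
  have key := h.second_phase hE hr.supp hF hL hcF (abs_nonneg _) hmax
  have hilam : ξ ^ 2 * |corr X y x i| ≤ 2 * N := by
    have hiv := hr.corr_le i (hEK ▸ hi)
    rcases hr.dominated i (hEK ▸ hi) with h1 | ⟨j, hj, h1⟩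
    · rw [le_antisymm (hiv.trans h1) (abs_nonneg _)]; linarith
    · have h2 := key j
      obtain ⟨h3, h4⟩ := hzero j (hEK ▸ hj)
      rw [h3, h4, sub_zero, sub_zero] at h2
      nlinarith [mul_le_mul_of_nonneg_left (hiv.trans h1) hξ.le]
  intro j
  by_cases hj : j ∈ signalSet β
  · have h1 := h.signal j (Finset.mem_filter.1 hj).2
    have h2 : |β j - x j| ≤ |corr X y x i| + |corr X y x j - (β j - x j)| := by
      have := abs_sub_abs_le_abs_sub (β j - x j) (corr X y x j)
      rw [abs_sub_comm (β j - x j)] at this; linarith [hmax j hj]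
    have h3 : ξ * |β j - x j| ≤ 2 * ξ * |corr X y x i| + 2 * N := by
      nlinarith [key j, mul_le_mul_of_nonneg_left h2 hξ.le,
        mul_nonneg (sq_nonneg ξ) (abs_nonneg (corr X y x i))]
    have h4 : ξ ^ 2 * |β j - x j| < ξ ^ 2 * |β j| := by
      nlinarith [mul_le_mul_of_nonneg_left h3 hξ.le]
    have h5 : |β j - x j| < |β j| := lt_of_mul_lt_mul_left h4 (sq_nonneg ξ)
    rcases lt_trichotomy (β j) 0 with h0 | h0 | h0
    · rw [abs_of_neg h0] at h5
      rw [sign_neg h0, sign_neg (by linarith [neg_abs_le (β j - x j)])]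
    · exact absurd h0 (Finset.mem_filter.1 hj).2
    · rw [abs_of_pos h0] at h5
      rw [sign_pos h0, sign_pos (by linarith [le_abs_self (β j - x j)])]
  · rw [(hzero j hj).1, (hzero j hj).2]

/-- The estimator is read off the FLASH path itself, at position `t = 0`. -/
lemma blockFlash (h : IsRecoverable X y β a b μ ξ N) :
    (∃ bhat, IsBlockFlash X y (midSet β b ξ).card (signalSet β).card 0 bhat) ∧
      ∀ bhat, IsBlockFlash X y (midSet β b ξ).card (signalSet β).card 0 bhat →
        RecoversSignedSupport bhat β := by
  constructor
  · obtain ⟨x, E, v, hrun, -⟩ := h.exists_run le_rfl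
    have hsupp : (Finset.univ.filter fun j => x j ≠ 0) ⊆ signalSet β := by
      intro j hj
      refine Finset.mem_filter.2 ⟨Finset.mem_univ _, ?_⟩
      have := (Finset.mem_filter.1 hj).2
      rwa [← sign_ne_zero, ← h.recovers_of_run hrun j, sign_ne_zero]
    -- with zero weights the weighted Lasso is least squares
    obtain ⟨b', hb'⟩ := exists_isWeightedLasso h.incoherent.norm_one
      (h.isRestrictedConvex hsupp) h.ξ_pos y (v := 0) (by simp)
    refine ⟨x, x, E, v, b', hrun, fun j => ⟨fun hj => hb'.1 j (by simp [hj]), fun hj => ?_⟩,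
      by simp⟩
    exact abs_nonpos_iff.1 (hb'.2 j (by simp [hj])).1
  · rintro bhat ⟨x, E, v, b', hrun, -, rfl⟩
    simpa using h.recovers_of_run hrun

end IsRecoverable

/-! ### The coherence bounds -/

section Coherence

variable {n p : ℕ} {X : Matrix (Fin n) (Fin p) ℝ} {β : Fin p → ℝ} {a b : Fin p}

lemma maxCorr_nonneg (X : Matrix (Fin n) (Fin p) ℝ) : 0 ≤ maxCorr X :=
  Real.iSup_nonneg fun _ => abs_nonneg _

lemma isIncoherent_maxCorr (hX : IsStandardized X) : IsIncoherent X (maxCorr X) := by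
  have hle : ∀ j k, k < j → |∑ i, X i j * X i k| ≤ maxCorr X := fun j k hjk =>
    le_ciSup (f := fun jk : {jk : Fin p × Fin p // jk.2 < jk.1} =>
      |∑ i, X i jk.1.1 * X i jk.1.2|) (Set.finite_range _).bddAbove ⟨(j, k), hjk⟩
  refine ⟨fun j => (hX j).2, fun j k hjk => ?_⟩
  rcases lt_or_gt_of_ne hjk with h | h
  · simpa only [mul_comm] using hle k j h
  · exact hle j k h

lemma card_signalSet_pos (hb : β b ≠ 0) : (0 : ℝ) < (signalSet β).card := by
  exact_mod_cast Finset.card_pos.2 ⟨b, Finset.mem_filter.2 ⟨Finset.mem_univ _, hb⟩⟩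

lemma fracLarge_mul_numSignal (hb : β b ≠ 0) (a : Fin p) :
    fracLarge β a * numSignal β = (largeSet β a).card :=
  div_mul_cancel₀ _ (card_signalSet_pos hb).ne'

lemma one_sub_fracSmall_mul_numSignal (hb : β b ≠ 0) :
    (1 - fracSmall β b) * numSignal β = (aboveSet β b).card := by
  have h1 : fracSmall β b * numSignal β
      = (Finset.univ.filter fun j => 0 < |β j| ∧ |β j| ≤ |β b|).card :=
    div_mul_cancel₀ _ (card_signalSet_pos hb).ne'
  have h2 : (Finset.univ.filter fun j => 0 < |β j| ∧ |β j| ≤ |β b|)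
      = signalSet β \ aboveSet β b := by
    ext j; simp [signalSet, aboveSet]
  have h3 := Finset.cast_card_sdiff (R := ℝ) (IsRecoverable.above_subset_signal (β := β) (b := b))
  rw [sub_mul, h1, h2, h3]
  change 1 * ((signalSet β).card : ℝ) - _ = _
  ring

lemma muFlash_eq (hb : β b ≠ 0) (a : Fin p) :
    muFlash β a b = min (1 / (2 * ((aboveSet β b).card : ℝ) - 1))
      (1 / (2 * ((signalSet β).card : ℝ) - (largeSet β a).card)) := by
  rw [muFlash, mul_assoc, one_sub_fracSmall_mul_numSignal hb, sub_mul,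
    fracLarge_mul_numSignal hb]
  rfl

lemma one_le_card_aboveSet (hab : |β b| < |β a|) : (1 : ℝ) ≤ (aboveSet β b).card := by
  exact_mod_cast Finset.card_pos.2 ⟨a, Finset.mem_filter.2 ⟨Finset.mem_univ _, hab⟩⟩

lemma card_largeSet_le (ha : β a ≠ 0) : ((largeSet β a).card : ℝ) ≤ (signalSet β).card := by
  refine Nat.cast_le.2 (Finset.card_le_card fun j hj => Finset.mem_filter.2 ⟨Finset.mem_univ _, ?_⟩)
  exact abs_pos.1 ((abs_pos.2 ha).trans_le (Finset.mem_filter.1 hj).2)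

lemma muLasso_lt_muFlash (ha : β a ≠ 0) (hb : β b ≠ 0) (hab : |β b| < |β a|)
    (hq : 1 < fracLarge β a * numSignal β) : muLasso β < muFlash β a b := by
  rw [fracLarge_mul_numSignal hb] at hq
  have h1 := one_le_card_aboveSet hab
  have h2 : ((aboveSet β b).card : ℝ) < (signalSet β).card := by
    refine Nat.cast_lt.2 (Finset.card_lt_card ⟨IsRecoverable.above_subset_signal, fun hsub => ?_⟩)
    have := hsub (Finset.mem_filter.2 ⟨Finset.mem_univ b, hb⟩)
    exact lt_irrefl _ (Finset.mem_filter.1 this).2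
  have h3 := card_largeSet_le ha
  rw [muFlash_eq hb, muLasso, lt_min_iff]
  change 1 / (2 * ((signalSet β).card : ℝ) - 1) < _ ∧ 1 / (2 * ((signalSet β).card : ℝ) - 1) < _
  exact ⟨one_div_lt_one_div_of_lt (by linarith) (by linarith),
    one_div_lt_one_div_of_lt (by linarith) (by linarith)⟩

end Coherence

/-! ### The noise -/

/-- The intercept and the centering are invisible to centered predictors. -/
lemma corr_centered_response {n p : ℕ} {X : Matrix (Fin n) (Fin p) ℝ} (hX : IsStandardized X)
    (β₀ : ℝ) (β : Fin p → ℝ) (e : Fin n → ℝ) (j : Fin p) :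
    corr X (centered (response X β₀ β e)) β j = ∑ i, X i j * e i := by
  set m := (∑ k, response X β₀ β e k) / n
  have h1 : ∀ i, X i j * (centered (response X β₀ β e) - X *ᵥ β) i
      = X i j * (β₀ - m) + X i j * e i := fun i => by
    have h2 : centered (response X β₀ β e) i = β₀ + (X *ᵥ β) i + e i - m := rfl
    rw [Pi.sub_apply, h2]
    ring
  change ∑ i, X i j * (centered (response X β₀ β e) - X *ᵥ β) i = _
  rw [Finset.sum_congr rfl fun i _ => h1 i, Finset.sum_add_distrib, ← Finset.sum_mul, (hX j).1]
  ring

/-- A union bound over the predictors for sub-Gaussian noise. -/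
lemma measureReal_exists_lt_abs_le {n p : ℕ} {X : Matrix (Fin n) (Fin p) ℝ}
    (hX : IsStandardized X) (hp : 0 < p) {σ : ℝ≥0} {Ω : Type*} [MeasurableSpace Ω]
    {P : Measure Ω} [IsProbabilityMeasure P] {ε : Fin n → Ω → ℝ} (hind : iIndepFun ε P)
    (hsub : ∀ i, HasSubgaussianMGF (ε i) (σ ^ 2) P) :
    P.real {ω | ∃ j, 2 * (σ + 1) * Real.sqrt (Real.log p) < |∑ i, X i j * ε i ω|} ≤ 2 / p := by
  set N : ℝ := 2 * (σ + 1) * Real.sqrt (Real.log p) with hN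
  have hN0 : 0 ≤ N := by positivity
  have hp0 : (0 : ℝ) < p := Nat.cast_pos.2 hp
  have hlog : 0 ≤ Real.log p := Real.log_natCast_nonneg p
  have hsum : ∀ j, HasSubgaussianMGF (fun ω => ∑ i, X i j * ε i ω) (σ ^ 2 + 1) P := fun j => by
    have h1 := HasSubgaussianMGF.sum_of_iIndepFun (s := Finset.univ)
      (hind.comp (fun i x => X i j * x) fun i => by fun_prop)
      (c := fun i => Real.toNNReal (X i j ^ 2) * σ ^ 2) (fun i _ => by
        rw [Real.toNNReal_of_nonneg (sq_nonneg _)]; exact (hsub i).const_mul (X i j))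
    refine ⟨h1.integrable_exp_mul, fun t => (h1.mgf_le t).trans (Real.exp_le_exp.2 ?_)⟩
    have h2 : ((∑ i, Real.toNNReal (X i j ^ 2) * σ ^ 2 : ℝ≥0) : ℝ) = (σ : ℝ) ^ 2 := by
      push_cast
      simp_rw [Real.coe_toNNReal _ (sq_nonneg _)]
      rw [← Finset.sum_mul, (hX j).2, one_mul]
    rw [h2]
    push_cast
    nlinarith [sq_nonneg t]
  -- the variance proxy `σ² + 1` keeps the exponent meaningful for `σ = 0`
  have hexp : Real.exp (-N ^ 2 / (2 * ((σ ^ 2 + 1 : ℝ≥0) : ℝ))) ≤ 1 / (p : ℝ) ^ 2 := by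
    have h1 : -N ^ 2 / (2 * ((σ ^ 2 + 1 : ℝ≥0) : ℝ)) ≤ -(2 * Real.log p) := by
      push_cast
      rw [div_le_iff₀ (by positivity), hN, mul_pow, Real.sq_sqrt hlog]
      nlinarith [mul_nonneg σ.coe_nonneg hlog]
    refine (Real.exp_le_exp.2 h1).trans_eq ?_
    rw [Real.exp_neg, two_mul, Real.exp_add, Real.exp_log hp0, one_div, sq]
  have hone : ∀ j, P.real {ω | N < |∑ i, X i j * ε i ω|} ≤ 2 / (p : ℝ) ^ 2 := fun j => by
    have h1 := ((hsum j).measure_ge_le hN0).trans hexp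
    have h2 := ((hsum j).neg.measure_ge_le hN0).trans hexp
    have h3 : {ω | N < |∑ i, X i j * ε i ω|}
        ⊆ {ω | N ≤ ∑ i, X i j * ε i ω} ∪ {ω | N ≤ (-fun ω => ∑ i, X i j * ε i ω) ω} := by
      intro ω hω
      have hω' : N < |∑ i, X i j * ε i ω| := hω
      rcases lt_abs.1 hω' with h | h
      · exact Or.inl h.le
      · exact Or.inr h.le
    calc _ ≤ _ := measureReal_mono h3
      _ ≤ _ := measureReal_union_le _ _
      _ ≤ 1 / (p : ℝ) ^ 2 + 1 / (p : ℝ) ^ 2 := add_le_add h1 h2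
      _ = 2 / (p : ℝ) ^ 2 := by ring
  have hU : {ω | ∃ j, N < |∑ i, X i j * ε i ω|} = ⋃ j, {ω | N < |∑ i, X i j * ε i ω|} := by
    ext ω; simp
  rw [hU]
  calc _ ≤ ∑ j, P.real {ω | N < |∑ i, X i j * ε i ω|} := measureReal_iUnion_fintype_le _
    _ ≤ ∑ _j : Fin p, 2 / (p : ℝ) ^ 2 := Finset.sum_le_sum fun j _ => hone j
    _ = 2 / p := by
      rw [Finset.sum_const, Finset.card_univ, Fintype.card_fin, nsmul_eq_mul]
      field_simp

/-- The assumptions of the theorem make the model recoverable whenever the noise is small. -/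
lemma isRecoverable_of_noise_le {n p : ℕ} {X : Matrix (Fin n) (Fin p) ℝ} (hX : IsStandardized X)
    {y : Fin n → ℝ} {β : Fin p → ℝ} {a b : Fin p} {ξ τ : ℝ} (hξ : 0 < ξ) (hτ : 0 ≤ τ)
    (hsig : ∀ j, β j ≠ 0 →
      7 * τ / ξ ^ 2 * Real.sqrt (numSignal β * Real.log p) < |β j|)
    (ha : β a ≠ 0) (hb : β b ≠ 0)
    (hsep : (60 / ξ ^ 3 + 1) * Real.sqrt (numSignal β) < |β a / β b|)
    (hμ : maxCorr X < muFlash β a b * (1 - ξ))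
    (hnoise : ∀ j, |corr X y β j| ≤ τ * Real.sqrt (Real.log p)) :
    |β b| < |β a| ∧
      IsRecoverable X y β a b (maxCorr X) ξ (τ * Real.sqrt (Real.log p)) := by
  have hS : (1 : ℝ) ≤ numSignal β := by
    have := card_signalSet_pos hb
    exact_mod_cast (Nat.cast_pos.1 this : 0 < (signalSet β).card)
  have hlog : 0 ≤ Real.log p := Real.log_natCast_nonneg p
  have hB := abs_pos.2 hb
  have hsep' : (60 / ξ ^ 3 + 1) * |β b| < |β a| := by
    rw [abs_div, lt_div_iff₀ hB] at hsep
    refine lt_of_le_of_lt ?_ hsep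
    exact mul_le_mul_of_nonneg_right
      (le_mul_of_one_le_right (by positivity) (Real.one_le_sqrt.2 hS)) hB.le
  have hξ3 : 0 < ξ ^ 3 := by positivity
  have hab : |β b| < |β a| := by
    nlinarith [mul_pos (div_pos (by norm_num : (0 : ℝ) < 60) hξ3) hB]
  have h1 := one_le_card_aboveSet hab
  have h2 := card_largeSet_le ha
  have h3 := card_signalSet_pos hb
  have hμ0 := maxCorr_nonneg X
  have hd1 : (0 : ℝ) < 2 * (aboveSet β b).card - 1 := by linarith
  have hd2 : (0 : ℝ) < 2 * (signalSet β).card - (largeSet β a).card := by linarith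
  have hpos : 0 < muFlash β a b := by
    rw [muFlash_eq hb]; exact lt_min (one_div_pos.2 hd1) (one_div_pos.2 hd2)
  have hξ1 : ξ < 1 := by
    have := pos_of_mul_pos_right (hμ0.trans_lt hμ) hpos.le
    linarith
  have hbound : ∀ d : ℝ, 0 < d → muFlash β a b ≤ 1 / d → maxCorr X * d ≤ 1 - ξ :=
    fun d hd hle => by
      rw [← le_div_iff₀ hd]
      calc maxCorr X ≤ muFlash β a b * (1 - ξ) := hμ.le
        _ ≤ 1 / d * (1 - ξ) := mul_le_mul_of_nonneg_right hle (by linarith)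
        _ = (1 - ξ) / d := by ring
  refine ⟨hab, isIncoherent_maxCorr hX, hμ0, hξ, hξ1, by positivity, hnoise, fun j hj => ?_, hb,
    ?_, hbound _ hd1 ?_, hbound _ hd2 ?_⟩
  · have h4 : Real.sqrt (Real.log p) ≤ Real.sqrt (numSignal β * Real.log p) :=
      Real.sqrt_le_sqrt (le_mul_of_one_le_left hlog hS)
    have h5 := (mul_le_mul_of_nonneg_left h4 (by positivity : 0 ≤ 7 * τ / ξ ^ 2)).trans_lt
      (hsig j hj)
    rw [div_mul_eq_mul_div, div_lt_iff₀ (by positivity)] at h5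
    linarith
  · have h4 : (60 / ξ ^ 3) * |β b| < |β a| := by linarith
    rw [div_mul_eq_mul_div, div_lt_iff₀ hξ3] at h4
    linarith
  · rw [muFlash_eq hb]; exact min_le_left _ _
  · rw [muFlash_eq hb]; exact min_le_right _ _

theorem theorem1 (σ : ℝ≥0) (ξ : ℝ) (hξ : 0 < ξ) :
    -- the constants depend only on the sub-Gaussian parameter and on `ξ`
    ∃ c₁ c₃ : ℝ, 0 < c₁ ∧ 0 < c₃ ∧
      ∀ (n p : ℕ → ℕ) (X : ∀ m, Matrix (Fin (n m)) (Fin (p m)) ℝ)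
        (β₀ : ℕ → ℝ) (β : ∀ m, Fin (p m) → ℝ) (a b : ∀ m, Fin (p m))
        (Ω : ℕ → Type*) [∀ m, MeasurableSpace (Ω m)]
        (P : ∀ m, Measure (Ω m)) [∀ m, IsProbabilityMeasure (P m)]
        (ε : ∀ m, Fin (n m) → Ω m → ℝ),
        Tendsto p atTop atTop →
        (∀ m, IsStandardized (X m)) →
        -- independent, mean zero, sub-Gaussian errors
        (∀ m, iIndepFun (ε m) (P m)) →
        (∀ m i, HasSubgaussianMGF (ε m i) (σ ^ 2) (P m)) →
        -- minimum signal condition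
        (∀ m j, β m j ≠ 0 →
          c₁ * Real.sqrt (numSignal (β m) * Real.log (p m)) < |β m j|) →
        -- separation of a pair of nonzero coefficients
        (∀ m, β m (a m) ≠ 0 ∧ β m (b m) ≠ 0 ∧
          c₃ * Real.sqrt (numSignal (β m)) < |β m (a m) / β m (b m)|) →
        -- correlation bound
        (∀ m, maxCorr (X m) < muFlash (β m) (a m) (b m) * (1 - ξ)) →
        -- non-random tuning parameters for which the block FLASH estimator exists and has
        -- the correct signs, up to an event whose (outer) probability tends to zero
        (∃ (lstar l : ℕ → ℕ) (t : ℕ → ℝ),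
          (∀ m, 1 ≤ lstar m ∧ t m ∈ Set.Icc (0 : ℝ) 1) ∧
          Tendsto (fun m => P m {ω | ¬ (
              (∃ bhat, IsBlockFlash (X m)
                (centered (response (X m) (β₀ m) (β m) (fun i => ε m i ω)))
                (lstar m) (l m) (t m) bhat) ∧
              ∀ bhat, IsBlockFlash (X m)
                (centered (response (X m) (β₀ m) (β m) (fun i => ε m i ω)))
                (lstar m) (l m) (t m) bhat → RecoversSignedSupport bhat (β m))})
            atTop (𝓝 0)) ∧
        -- comparison with the Lasso bound
        ∀ m, 1 < fracLarge (β m) (a m) * numSignal (β m) →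
          muLasso (β m) < muFlash (β m) (a m) (b m) := by
  set τ : ℝ := 2 * (σ + 1) with hτ
  have hτ0 : 0 < τ := by positivity
  refine ⟨7 * τ / ξ ^ 2, 60 / ξ ^ 3 + 1, by positivity, by positivity, ?_⟩
  intro n p X β₀ β a b Ω _ P _ ε hp hX hind hsub hsig hsep hμ
  have hrec : ∀ m y, (∀ j, |corr (X m) y (β m) j| ≤ τ * Real.sqrt (Real.log (p m))) →
      |β m (b m)| < |β m (a m)| ∧ IsRecoverable (X m) y (β m) (a m) (b m) (maxCorr (X m)) ξ
        (τ * Real.sqrt (Real.log (p m))) := fun m y hy =>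
    isRecoverable_of_noise_le (hX m) hξ hτ0.le (hsig m) (hsep m).1 (hsep m).2.1 (hsep m).2.2
      (hμ m) hy
  -- the noiseless response shows what holds deterministically
  have hdet := fun m => hrec m (X m *ᵥ β m) fun j => by
    simp only [corr, sub_self, Matrix.mulVec_zero, Pi.zero_apply, abs_zero]; positivity
  refine ⟨⟨fun m => (midSet (β m) (b m) ξ).card, fun m => (signalSet (β m)).card, fun _ => 0,
    fun m => ⟨(hdet m).2.mid_card_pos, by simp⟩, ?_⟩, fun m hq =>
    muLasso_lt_muFlash (hsep m).1 (hsep m).2.1 (hdet m).1 hq⟩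
  have hlim : Tendsto (fun m => ENNReal.ofReal (2 / (p m : ℝ))) atTop (𝓝 0) := by
    rw [← ENNReal.ofReal_zero]
    exact (ENNReal.continuous_ofReal.tendsto 0).comp
      (tendsto_const_nhds.div_atTop (tendsto_natCast_atTop_atTop.comp hp))
  refine tendsto_of_tendsto_of_tendsto_of_le_of_le tendsto_const_nhds hlim
    (fun _ => zero_le) fun m => ?_
  have hbad := measureReal_exists_lt_abs_le (hX m) (Fin.pos (a m)) (hind m) (hsub m)
  refine (measure_mono fun ω hω => ?_).trans
    ((ENNReal.le_ofReal_iff_toReal_le (measure_ne_top _ _) (by positivity)).2 hbad)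
  by_contra hgood
  refine hω (hrec m _ fun j => ?_).2.blockFlash
  rw [corr_centered_response (hX m)]
  by_contra! hlt
  exact hgood ⟨j, hlt⟩
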